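/- All densities are pointwise-defined probability densities on $\mathbb R$ with respect to Lebesgue measure $\mu$, and $\|\cdot\|$ is the norm of $L_1(\mathbb R,\mu)$. A finite nonempty set $A\subset\mathbb R$ cuts the line into $|A|+1$ open intervals; denote by $\mathbf I(A)$ the set of these intervals. Let $\overline{\mathcal M}_4^1$ be the set of densities $g$ for which there is a nonempty set $A$ of at most $3$ points such that, on each $I\in\mathbf I(A)$, $g$ is monotone and is either convex or concave. For $D\ge 1$, let $\overline{\mathcal O}_{D,4}^1$ be the set of those $g\in\overline{\mathcal M}_4^1$ that are left-continuous on $\mathbb R$ and for which there is a nonempty set $B$ of at most $D+1$ points such that $g$ is affine on each $I\in\mathbf I(B)$. For each $D\ge 1$ let $\mathcal O_{D,4}^1$ be a countable subset of $\overline{\mathcal O}_{D,4}^1$ that is dense in it for $\|\cdot\|$, and let $\mathcal M_4^1$ be a countable subset of $\overline{\mathcal M}_4^1$ that is dense in it for $\|\cdot\|$ and that contains $\bigcup_{D\ge 1}\mathcal O_{D,4}^1$. Let $n\ge 1$. A density estimator based on $n$ observations is a measurable map $x\mapsto\widetilde p(x)$ from $\mathbb R^n$ to the set of densities, seen as a subset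 of $L_1(\mathbb R,\mu)$. For $x\in\mathbb R^n$ and $p,q\in\mathcal M_4^1$ put $$\mathbf T(x,p,q)=\sum_{i=1}^n\Big[\mathbf 1_{\{q>p\}}(x_i)-\int_{\{q>p\}}p\,d\mu\Big],\qquad \mathbf T(x,p)=\sup_{q\in\mathcal M_4^1}\mathbf T(x,p,q).$$ For $\varepsilon>0$, a TV-estimator on $\mathcal M_4^1$ is any density estimator $\widehat p$ such that, for all $x\in\mathbb R^n$, $\widehat p(x)\in\mathcal M_4^1$ and $\mathbf T(x,\widehat p(x))\le\inf_{p'\in\mathcal M_4^1}\mathbf T(x,p')+\varepsilon$. If $X_1,\dots,X_n$ are i.i.d. with a density $p$ that vanishes outside an interval of $\mathbb R$ and is concave on this interval, then, for all $\varepsilon>0$ and all choices of the countable dense sets above, any TV-estimator $\widehat p=\widehat p(X_1,\dots,X_n)$ on $\mathcal M_4^1$ satisfies $$\mathbb E\big[\|p-\widehat p\|\big]\le\frac{320}{n^{2/5}}+\frac{451}{\sqrt n}+\frac{2\varepsilon}{n}.$$ Moreover, $$\inf_{\widetilde p}\sup_p\mathbb E\big[\|p-\widetilde p\|\big]\le\frac{320}{n^{2/5}}+\frac{451}{\sqrt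 n},$$ where the supremum runs over all densities $p$ that vanish outside some interval of $\mathbb R$ and are concave on it, and the infimum over all density estimators $\widetilde p$ based on $n$ i.i.d. observations $X_1,\dots,X_n$ with density $p$. -/

import Mathlib

open MeasureTheory
open scoped ENNReal

noncomputable section

namespace TVEst

/-- A probability density on the line with respect to Lebesgue measure. -/
structure IsDensity (p : ℝ → ℝ) : Prop where
  measurable : Measurable p
  nonneg : ∀ x, 0 ≤ p x
  integrable : Integrable p volume
  integral_eq_one : ∫ x, p x = 1

/-- The law `p · μ` on the line, where `μ` is Lebesgue measure. -/
def law (p : ℝ → ℝ) : Measure ℝ :=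
  volume.withDensity fun x => ENNReal.ofReal (p x)

/-- The `L₁`-norm of `p - q`. -/
def dist₁ (p q : ℝ → ℝ) : ℝ≥0∞ :=
  eLpNorm (fun x => p x - q x) 1 volume

/-- `M` is a countable subset of `Mbar` that is dense in `Mbar` for the `L₁`-norm. -/
structure IsCountableDense (M Mbar : Set (ℝ → ℝ)) : Prop where
  countable : M.Countable
  subset : M ⊆ Mbar
  dense : ∀ p ∈ Mbar, ∀ δ : ℝ, 0 < δ → ∃ q ∈ M, dist₁ p q < ENNReal.ofReal δ

/-! ### Shape-constrained models -/

/-- The open intervals into which a finite set `A` cuts the line: the order-connected components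
of the complement of `A`. -/
def pieces (A : Finset ℝ) : Set (Set ℝ) :=
  {I | ∃ x ∈ (A : Set ℝ)ᶜ, I = Set.ordConnectedComponent (A : Set ℝ)ᶜ x}

/-- `g` is monotone (nondecreasing or nonincreasing) on `I`. -/
def IsMonotoneOn (g : ℝ → ℝ) (I : Set ℝ) : Prop :=
  MonotoneOn g I ∨ AntitoneOn g I

/-- `g` is convex-concave (convex or concave) on `I`. -/
def IsConvexConcaveOn (g : ℝ → ℝ) (I : Set ℝ) : Prop :=
  ConvexOn ℝ I g ∨ ConcaveOn ℝ I g

/-- `g` is `k`-piecewise monotone convex-concave. -/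
def IsPiecewiseMonotoneConvexConcave (k : ℕ) (g : ℝ → ℝ) : Prop :=
  ∃ A : Finset ℝ, A.Nonempty ∧ A.card ≤ k - 1 ∧
    ∀ I ∈ pieces A, IsMonotoneOn g I ∧ IsConvexConcaveOn g I

/-- The model of `k`-piecewise monotone convex-concave densities (for `k ≥ 2`). -/
def Mbar (k : ℕ) : Set (ℝ → ℝ) :=
  {p | IsDensity p ∧ IsPiecewiseMonotoneConvexConcave k p}

/-- The densities of `Mbar k` that are left-continuous and that are affine on each of the open
intervals into which some nonempty set of at most `D + 1` points cuts the line. -/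
def Obar (D k : ℕ) : Set (ℝ → ℝ) :=
  {p | p ∈ Mbar k ∧ (∀ x, ContinuousWithinAt p (Set.Iic x) x) ∧
    ∃ A : Finset ℝ, A.Nonempty ∧ A.card ≤ D + 1 ∧
      ∀ I ∈ pieces A, ∃ a b : ℝ, ∀ x ∈ I, p x = a * x + b}

/-- The densities that vanish outside some interval and are concave on it. -/
def concaveDensities : Set (ℝ → ℝ) :=
  {p | IsDensity p ∧ ∃ I : Set ℝ, I.OrdConnected ∧ (∀ x ∉ I, p x = 0) ∧ ConcaveOn ℝ I p}

/-! ### Estimators and their risk -/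

/-- A density estimator based on `n` real observations: a measurable map from the sample space to
the densities, the latter being viewed in the separable space `L₁`. -/
structure DensityEstimator (n : ℕ) where
  toFun : (Fin n → ℝ) → ℝ → ℝ
  isDensity : ∀ x, IsDensity (toFun x)
  stronglyMeasurable :
    StronglyMeasurable fun x => (isDensity x).integrable.toL1 (toFun x)

/-- The `L₁`-risk of an estimator when the observations are i.i.d. with density `p`. -/
def risk {n : ℕ} (p : ℝ → ℝ) (pt : DensityEstimator n) : ℝ≥0∞ :=
  ∫⁻ x, dist₁ p (pt.toFun x) ∂(Measure.pi fun _ : Fin n => law p)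

/-! ### The TV-estimator -/

/-- The test function `1_{q > p} - P(q > p)` with `P = p · μ`. -/
def test (p q : ℝ → ℝ) (x : ℝ) : ℝ :=
  Set.indicator {y | p y < q y} 1 x - (law p).real {y | p y < q y}

/-- The sum of the tests `test p q` over the observations. -/
def testSum {n : ℕ} (x : Fin n → ℝ) (p q : ℝ → ℝ) : ℝ :=
  ∑ i, test p q (x i)

/-- The supremum over `q ∈ M` of `testSum x p q`. -/
def crit {n : ℕ} (M : Set (ℝ → ℝ)) (x : Fin n → ℝ) (p : ℝ → ℝ) : ℝ :=
  ⨆ q : M, testSum x p q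

/-- A TV-estimator on `M`: an estimator with values in `M` that minimizes the criterion
`crit M x` over `M` up to `ε`. -/
def IsTVEstimator {n : ℕ} (M : Set (ℝ → ℝ)) (ε : ℝ) (pt : DensityEstimator n) : Prop :=
  ∀ x, pt.toFun x ∈ M ∧ crit M x (pt.toFun x) ≤ (⨅ q : M, crit M x q) + ε

end TVEst

end

noncomputable section

namespace TVEst

/-! ### Fourth moments of sums of independent variables -/

section Moments

open ProbabilityTheory

variable {Ω ι : Type*} [MeasurableSpace Ω] {μ : Measure Ω} [IsProbabilityMeasure μ]

/-! The estimator is compared with one fixed `p₀` in the model that is close to `p` and affine on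
few intervals. Half of `‖p - q‖` is the largest difference of the two laws over all sets, attained
at `{q > p}`. Near-minimality of the criterion therefore gives `‖p - p̂‖ ≤ 3 ‖p - p₀‖ + 4 u + 2 ε /
n`, where `u` bounds the deviations of the empirical measure at the sets `{q > p₀}` and `{q < p₀}`
for all `q` in the model (`integral_abs_sub_le_of_crit_le`).

These sets are simple because `p₀` is piecewise affine: off finitely many points `q - p₀` is convex
or concave, hence each piece adds at most two sign changes. With `D` as in `Obar D 4`, at most `m =
3 D + 14` points bound each set (`exists_cutBy_lt`). Chaining along nested partitions of the line
into cells of equal mass then dominates all deviations at such sets by one integrable variable of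
mean at most `26 √(m / n)` (`exists_uniform_empDev_bound`). Only fourth moments of the cell
deviations are used, and no measurability of a supremum is needed.

For the approximation, a concave function is bounded above by a minimum of tangents. Cutting the
triangle between chord and majorant by a tangent parallel to the chord divides the error bound by at
least four while doubling the number of pieces (`exists_majorants`). Thus `D` of order `R` costs a
bias of order `R⁻²` and a deviation of order `√(R / n)`; the choice `R ≈ n ^ (1/5)` balances them
(`rate_le`).

The minimax bound follows by building a TV-estimator for arbitrarily small `ε`
(`exists_isTVEstimator`). -/

theorem moments_sum_le {Y : ι → Ω → ℝ} (hY : ∀ i, Measurable (Y i)) (hind : iIndepFun Y μ)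
    (hb : ∀ i ω, |Y i ω| ≤ 1) (h0 : ∀ i, ∫ ω, Y i ω ∂μ = 0) {v : ℝ}
    (hv : ∀ i, ∫ ω, Y i ω ^ 2 ∂μ ≤ v) (s : Finset ι) :
    ∫ ω, ∑ i ∈ s, Y i ω ∂μ = 0 ∧ ∫ ω, (∑ i ∈ s, Y i ω) ^ 2 ∂μ ≤ s.card * v ∧
      ∫ ω, (∑ i ∈ s, Y i ω) ^ 4 ∂μ ≤ 3 * (s.card * v) ^ 2 + s.card * v := by
  classical
  induction s using Finset.induction_on with
  | empty => simp
  | insert a s ha ih =>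
    obtain ⟨ih1, ih2, ih4⟩ := ih
    set S : Ω → ℝ := fun ω => ∑ i ∈ s, Y i ω with hS
    have hSm : Measurable S := Finset.measurable_sum _ fun i _ => hY i
    have hSb : ∀ ω, |S ω| ≤ s.card := fun ω => by
      refine (Finset.abs_sum_le_sum_abs _ _).trans ?_
      refine (Finset.sum_le_sum fun i _ => hb i ω).trans ?_
      simp
    have hindSY : IndepFun S (Y a) μ := by
      have := hind.indepFun_finsetSum_of_notMem hY ha
      convert this using 1
      ext ω
      simp [hS]
    have hv0 : 0 ≤ v := (integral_nonneg fun ω => sq_nonneg (Y a ω)).trans (hv a)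
    have hint : ∀ k l : ℕ, Integrable (fun ω => S ω ^ k * Y a ω ^ l) μ := fun k l => by
      refine Integrable.of_bound ((hSm.pow_const k).mul ((hY a).pow_const l)).aestronglyMeasurable
        ((s.card : ℝ) ^ k * 1 ^ l) (Filter.Eventually.of_forall fun ω => ?_)
      rw [norm_mul, norm_pow, norm_pow, Real.norm_eq_abs, Real.norm_eq_abs]
      gcongr
      · exact hSb ω
      · exact hb a ω
    have hmul : ∀ k l : ℕ, ∫ ω, S ω ^ k * Y a ω ^ l ∂μ
        = (∫ ω, S ω ^ k ∂μ) * ∫ ω, Y a ω ^ l ∂μ := fun k l => by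
      have h := hindSY.comp (φ := fun t : ℝ => t ^ k) (ψ := fun t : ℝ => t ^ l)
        (measurable_id.pow_const k) (measurable_id.pow_const l)
      exact h.integral_fun_mul_eq_mul_integral (hSm.pow_const k).aestronglyMeasurable
        ((hY a).pow_const l).aestronglyMeasurable
    have hcard : ((insert a s).card : ℝ) = s.card + 1 := by
      rw [Finset.card_insert_of_notMem ha]; push_cast; ring
    have hsum : ∀ ω, ∑ i ∈ insert a s, Y i ω = S ω + Y a ω := fun ω => by
      rw [Finset.sum_insert ha, add_comm]
    have i10 : Integrable S μ := by simpa using hint 1 0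
    have i01 : Integrable (Y a) μ := by simpa using hint 0 1
    have i20 : Integrable (fun ω => S ω ^ 2) μ := by simpa using hint 2 0
    have i02 : Integrable (fun ω => Y a ω ^ 2) μ := by simpa using hint 0 2
    have i40 : Integrable (fun ω => S ω ^ 4) μ := by simpa using hint 4 0
    have i04 : Integrable (fun ω => Y a ω ^ 4) μ := by simpa using hint 0 4
    have m11 : ∫ ω, S ω ^ 1 * Y a ω ^ 1 ∂μ = 0 := by rw [hmul]; simp [h0 a]
    have m31 : ∫ ω, S ω ^ 3 * Y a ω ^ 1 ∂μ = 0 := by rw [hmul]; simp [h0 a]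
    have m13 : ∫ ω, S ω ^ 1 * Y a ω ^ 3 ∂μ = 0 := by rw [hmul]; simp [ih1]
    have m22 : ∫ ω, S ω ^ 2 * Y a ω ^ 2 ∂μ ≤ s.card * v * v := by
      rw [hmul]
      exact mul_le_mul ih2 (hv a) (integral_nonneg fun ω => sq_nonneg _) (by positivity)
    have m04 : ∫ ω, Y a ω ^ 4 ∂μ ≤ v := by
      refine (integral_mono i04 i02 fun ω => ?_).trans (hv a)
      have h1 : Y a ω ^ 2 ≤ 1 := (sq_le_one_iff_abs_le_one _).2 (hb a ω)
      change Y a ω ^ 4 ≤ Y a ω ^ 2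
      nlinarith [sq_nonneg (Y a ω)]
    simp only [hsum, hcard]
    refine ⟨?_, ?_, ?_⟩
    · rw [integral_add i10 i01, ih1, h0 a, add_zero]
    · have e : ∀ ω, (S ω + Y a ω) ^ 2 = S ω ^ 2 + 2 * (S ω ^ 1 * Y a ω ^ 1) + Y a ω ^ 2 :=
        fun ω => by ring
      simp only [e]
      rw [integral_add (i20.fun_add ((hint 1 1).const_mul 2)) i02,
        integral_add i20 ((hint 1 1).const_mul 2), integral_const_mul, m11]
      linarith [hv a]
    · have e : ∀ ω, (S ω + Y a ω) ^ 4 = S ω ^ 4 + 4 * (S ω ^ 3 * Y a ω ^ 1)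
          + 6 * (S ω ^ 2 * Y a ω ^ 2) + 4 * (S ω ^ 1 * Y a ω ^ 3) + Y a ω ^ 4 := fun ω => by ring
      simp only [e]
      have j1 := i40.fun_add ((hint 3 1).const_mul 4)
      have j2 := j1.fun_add ((hint 2 2).const_mul 6)
      have j3 := j2.fun_add ((hint 1 3).const_mul 4)
      rw [integral_add j3 i04, integral_add j2 ((hint 1 3).const_mul 4),
        integral_add j1 ((hint 2 2).const_mul 6), integral_add i40 ((hint 3 1).const_mul 4),
        integral_const_mul, integral_const_mul, integral_const_mul, m31, m13]
      nlinarith [sq_nonneg v]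

end Moments

/-! ### Deviations of the empirical measure -/

/-- The deviation of the empirical measure of the sample `x` from `μ` at the set `S`. -/
def empDev {n : ℕ} (μ : Measure ℝ) (x : Fin n → ℝ) (S : Set ℝ) : ℝ :=
  (∑ i, S.indicator 1 (x i)) / n - μ.real S

section EmpDev

variable {n : ℕ} {μ : Measure ℝ}

theorem measurable_empDev {S : Set ℝ} (hS : MeasurableSet S) :
    Measurable fun x : Fin n → ℝ => empDev μ x S := by
  unfold empDev
  refine ((Finset.measurable_sum _ fun i _ => ?_).div_const _).sub_const _
  exact (measurable_one.indicator hS).comp (measurable_pi_apply i)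

variable [IsProbabilityMeasure μ]

theorem abs_empDev_le (hn : 1 ≤ n) (x : Fin n → ℝ) (S : Set ℝ) : |empDev μ x S| ≤ 1 := by
  have hn' : (0 : ℝ) < n := by exact_mod_cast hn
  have h0 : 0 ≤ ∑ i, S.indicator (1 : ℝ → ℝ) (x i) :=
    Finset.sum_nonneg fun i _ => Set.indicator_nonneg (fun _ _ => zero_le_one) _
  have h1 : ∑ i, S.indicator (1 : ℝ → ℝ) (x i) ≤ n := by
    refine (Finset.sum_le_sum (g := fun _ => (1 : ℝ)) fun i _ => ?_).trans (by simp)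
    exact Set.indicator_le_self' (fun _ _ => zero_le_one) _
  have h2 : (∑ i, S.indicator (1 : ℝ → ℝ) (x i)) / n ≤ 1 := (div_le_one hn').2 h1
  have h3 : 0 ≤ (∑ i, S.indicator (1 : ℝ → ℝ) (x i)) / n := by positivity
  have h4 : μ.real S ≤ 1 := measureReal_le_one
  have h5 : 0 ≤ μ.real S := measureReal_nonneg
  rw [abs_le, empDev]
  constructor <;> linarith

theorem empDev_union {S T : Set ℝ} (hT : MeasurableSet T) (h : Disjoint S T) (x : Fin n → ℝ) :
    empDev μ x (S ∪ T) = empDev μ x S + empDev μ x T := by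
  unfold empDev
  rw [measureReal_union h hT, Set.indicator_union_of_disjoint h]
  simp only [Finset.sum_add_distrib]
  ring

theorem empDev_preimage {φ : ℝ → ℕ} (hφ : Measurable φ) (σ : Finset ℕ) (x : Fin n → ℝ) :
    empDev μ x (φ ⁻¹' σ) = ∑ c ∈ σ, empDev μ x (φ ⁻¹' {c}) := by
  classical
  induction σ using Finset.induction_on with
  | empty => simp [empDev]
  | insert a σ ha ih =>
    rw [Finset.sum_insert ha, ← ih, Finset.coe_insert, Set.insert_eq, Set.preimage_union,
      empDev_union (hφ (Set.to_countable _).measurableSet)]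
    refine Disjoint.preimage _ ?_
    simpa using ha

/-- The assumption `1 ≤ n * a` lets the Gaussian term `3 (n a) ^ 2` of the fourth moment absorb the
Poisson term `n a`. -/
theorem integral_empDev_pow_four_le (hn : 1 ≤ n) {S : Set ℝ} (hS : MeasurableSet S) {a : ℝ}
    (ha : μ.real S ≤ a) (hna : 1 ≤ n * a) :
    ∫ x : Fin n → ℝ, empDev μ x S ^ 4 ∂(Measure.pi fun _ => μ) ≤ 4 * a ^ 2 / n ^ 2 := by
  have hn' : (0 : ℝ) < n := by exact_mod_cast hn
  have h0 : 0 ≤ μ.real S := measureReal_nonneg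
  have h1 : μ.real S ≤ 1 := measureReal_le_one
  set f : ℝ → ℝ := fun t => S.indicator 1 t - μ.real S with hf
  have hfm : Measurable f := (measurable_one.indicator hS).sub_const _
  have hfb : ∀ t, |f t| ≤ 1 := fun t => by
    simp only [hf]
    by_cases ht : t ∈ S <;> simp [ht, abs_le] <;> linarith
  have hind : ∫ t, S.indicator (1 : ℝ → ℝ) t ∂μ = μ.real S := integral_indicator_one hS
  have hii : Integrable (S.indicator (1 : ℝ → ℝ)) μ :=
    (integrable_const (1 : ℝ)).indicator hS
  have hf0 : ∫ t, f t ∂μ = 0 := by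
    simp only [hf]
    rw [integral_sub hii (integrable_const _), hind]; simp
  have hf2 : ∫ t, f t ^ 2 ∂μ ≤ a := by
    have e : ∀ t, f t ^ 2 = (1 - 2 * μ.real S) * S.indicator 1 t + μ.real S ^ 2 := fun t => by
      simp only [hf]
      by_cases ht : t ∈ S <;> simp [ht]
      ring
    simp only [e]
    rw [integral_add (hii.const_mul _) (integrable_const _), integral_const_mul, hind]
    simp
    nlinarith
  have key := moments_sum_le (μ := Measure.pi fun _ : Fin n => μ)
    (Y := fun i x => f (x i)) (fun i => hfm.comp (measurable_pi_apply i))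
    (ProbabilityTheory.iIndepFun_pi (X := fun _ => f) fun i => hfm.aemeasurable)
    (fun i x => hfb _) (v := a)
    (fun i => by
      rw [← hf0]
      exact integral_comp_eval (μ := fun _ : Fin n => μ) (i := i) (f := f)
        hfm.aestronglyMeasurable)
    (fun i => by
      refine le_trans (le_of_eq ?_) hf2
      exact integral_comp_eval (μ := fun _ : Fin n => μ) (i := i) (f := fun t => f t ^ 2)
        (hfm.pow_const 2).aestronglyMeasurable) Finset.univ
  have e : ∀ x : Fin n → ℝ, empDev μ x S ^ 4 = (∑ i, f (x i)) ^ 4 * (1 / n ^ 4) := fun x => by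
    have : empDev μ x S = (∑ i, f (x i)) / n := by
      simp only [hf, empDev, Finset.sum_sub_distrib]
      simp
      field_simp
    rw [this]; ring
  simp only [e]
  rw [integral_mul_const]
  have := key.2.2
  simp only [Finset.card_univ, Fintype.card_fin] at this
  calc _ ≤ (3 * (n * a) ^ 2 + n * a) * (1 / n ^ 4 : ℝ) := by gcongr
    _ ≤ (4 * (n * a) ^ 2) * (1 / n ^ 4 : ℝ) := by gcongr; nlinarith
    _ = _ := by field_simp

end EmpDev

/-! ### Chaining over sets with few boundary points -/

/-- Every interval that avoids `B` is contained in `C` or disjoint from `C`. -/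
def CutBy (B : Finset ℝ) (C : Set ℝ) : Prop :=
  ∀ I : Set ℝ, I.OrdConnected → Disjoint I B → I ⊆ C ∨ Disjoint I C

/-- The index of the cell containing `t` when `μ` is cut into `N` cells of equal mass. -/
def cellIndex (μ : Measure ℝ) (N : ℕ) (t : ℝ) : ℕ :=
  ⌊(N : ℝ) * μ.real (Set.Iic t)⌋₊

section Cells

variable {μ : Measure ℝ} [IsProbabilityMeasure μ]

theorem cellIndex_mono (N : ℕ) : Monotone (cellIndex μ N) := fun s t h => by
  refine Nat.floor_mono (mul_le_mul_of_nonneg_left ?_ (Nat.cast_nonneg _))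
  exact measureReal_mono (Set.Iic_subset_Iic.2 h)

theorem measurable_cellIndex (N : ℕ) : Measurable (cellIndex μ N) :=
  (cellIndex_mono N).measurable

theorem cellIndex_lt (N : ℕ) (t : ℝ) : cellIndex μ N t < N + 1 := by
  rw [Nat.lt_succ_iff]
  refine Nat.floor_le_of_le ?_
  exact mul_le_of_le_one_right (Nat.cast_nonneg _) measureReal_le_one

-- Doubling `N` refines the partition: each cell splits into at most two, with indices `2 d` and `2
-- d + 1`.
omit [IsProbabilityMeasure μ] in
theorem cellIndex_two_mul (N : ℕ) (t : ℝ) : cellIndex μ (N * 2) t / 2 = cellIndex μ N t := by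
  unfold cellIndex
  rw [← Nat.floor_div_natCast]
  congr 1
  push_cast
  ring

theorem ordConnected_cell (N c : ℕ) : (cellIndex μ N ⁻¹' {c}).OrdConnected := by
  have h : (Set.Icc c c).OrdConnected := Set.ordConnected_Icc
  rw [Set.Icc_self] at h
  exact h.preimage_mono (cellIndex_mono N)

/-- By inner regularity a compact part of the cell suffices. Its extreme points lie in the cell, so
the distribution function varies by less than `1 / N` between them, and the absence of atoms turns
this variation into the mass of the closed interval. -/
theorem measureReal_cell_le [NullSingletonClass μ] {N : ℕ} (hN : 1 ≤ N) (c : ℕ) :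
    μ.real (cellIndex μ N ⁻¹' {c}) ≤ 1 / N := by
  have hN' : (0 : ℝ) < N := by exact_mod_cast hN
  by_contra! hlt
  have hm : MeasurableSet (cellIndex μ N ⁻¹' {c}) := measurable_cellIndex N (measurableSet_singleton c)
  have hlt' : ENNReal.ofReal (1 / N) < μ (cellIndex μ N ⁻¹' {c}) := by
    rw [← ofReal_measureReal]
    exact (ENNReal.ofReal_lt_ofReal_iff_of_nonneg (by positivity)).2 hlt
  obtain ⟨K, hK, hKc, hKlt⟩ := hm.exists_lt_isCompact_of_ne_top (measure_ne_top _ _) hlt'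
  have hne : K.Nonempty := by
    rw [Set.nonempty_iff_ne_empty]
    rintro rfl
    simp at hKlt
  have hu := hKc.sInf_mem hne
  have hv := hKc.sSup_mem hne
  set u := sInf K
  set v := sSup K
  have hsub : K ⊆ Set.Icc u v := fun t ht =>
    ⟨csInf_le hKc.bddBelow ht, le_csSup hKc.bddAbove ht⟩
  have huv : u ≤ v := (hsub hu).2
  have h1 : μ.real (Set.Icc u v) = μ.real (Set.Iic v) - μ.real (Set.Iic u) := by
    rw [measureReal_congr (Ioc_ae_eq_Icc (μ := μ) (a := u) (b := v)).symm, ← Set.Iic_sdiff_Iic,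
      measureReal_sdiff (Set.Iic_subset_Iic.2 huv) measurableSet_Iic]
  have hcu : cellIndex μ N u = c := hK hu
  have hcv : cellIndex μ N v = c := hK hv
  have h2 : (c : ℝ) ≤ N * μ.real (Set.Iic u) := by
    rw [← hcu]; exact Nat.floor_le (by positivity)
  have h3 : N * μ.real (Set.Iic v) < (c : ℝ) + 1 := by
    rw [← hcv]; exact Nat.lt_floor_add_one _
  have h4 : μ.real K ≤ 1 / N := by
    refine (measureReal_mono hsub).trans ?_
    rw [h1, le_div_iff₀ hN']
    nlinarith
  have h5 : μ K ≤ ENNReal.ofReal (1 / N) := by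
    rw [← ofReal_measureReal]
    exact ENNReal.ofReal_le_ofReal h4
  exact absurd hKlt (not_lt.2 h5)

end Cells

/-- Young's inequality at a free scale `τ`, with equality at `|d| = τ`. It makes the chaining
uniform: the fourth powers can be summed over all cells of a level, whichever cells a given set
selects. -/
theorem abs_le_fourth (d : ℝ) {τ : ℝ} (hτ : 0 < τ) : |d| ≤ 3 * τ / 4 + d ^ 4 / (4 * τ ^ 3) := by
  have h : d ^ 4 = |d| ^ 4 := by rw [← abs_pow, abs_of_nonneg (by positivity)]
  rw [h]
  generalize |d| = e
  have : 3 * τ / 4 + e ^ 4 / (4 * τ ^ 3) - e = (e - τ) ^ 2 * ((e + τ) ^ 2 + 2 * τ ^ 2) / (4 * τ ^ 3) := by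
    field_simp
    ring
  have h2 : 0 ≤ (e - τ) ^ 2 * ((e + τ) ^ 2 + 2 * τ ^ 2) / (4 * τ ^ 3) := by positivity
  linarith

/-- A bound for the sum of the absolute deviations over at most `2 m` of the cells at level `i`. -/
def levelBound {n : ℕ} (μ : Measure ℝ) (m i : ℕ) (τ : ℝ) (x : Fin n → ℝ) : ℝ :=
  3 / 2 * m * τ + (∑ c ∈ Finset.range (m * 2 ^ i + 1),
    empDev μ x (cellIndex μ (m * 2 ^ i) ⁻¹' {c}) ^ 4) / (4 * τ ^ 3)

section Chaining

variable {n : ℕ} {μ : Measure ℝ} [IsProbabilityMeasure μ]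

omit [IsProbabilityMeasure μ] in
theorem sum_abs_empDev_le_levelBound {m i : ℕ} {τ : ℝ} (hτ : 0 < τ) (x : Fin n → ℝ)
    {σ : Finset ℕ} (hσ : σ ⊆ Finset.range (m * 2 ^ i + 1)) (hc : σ.card ≤ 2 * m) :
    ∑ c ∈ σ, |empDev μ x (cellIndex μ (m * 2 ^ i) ⁻¹' {c})| ≤ levelBound μ m i τ x := by
  have hc' : (σ.card : ℝ) ≤ 2 * m := by exact_mod_cast hc
  calc _ ≤ ∑ c ∈ σ, (3 * τ / 4 + empDev μ x (cellIndex μ (m * 2 ^ i) ⁻¹' {c}) ^ 4 / (4 * τ ^ 3)) :=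
        Finset.sum_le_sum fun c _ => abs_le_fourth _ hτ
    _ = σ.card * (3 * τ / 4)
        + (∑ c ∈ σ, empDev μ x (cellIndex μ (m * 2 ^ i) ⁻¹' {c}) ^ 4) / (4 * τ ^ 3) := by
        rw [Finset.sum_add_distrib, Finset.sum_div]; simp
    _ ≤ _ := by
        unfold levelBound
        gcongr ?_ + ?_ / _
        · nlinarith
        · exact Finset.sum_le_sum_of_subset_of_nonneg hσ fun c _ _ => by positivity

/-- The union of the cells that are contained in `C`. -/
def innerCells (μ : Measure ℝ) (N : ℕ) (C : Set ℝ) : Set ℝ :=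
  {t | cellIndex μ N ⁻¹' {cellIndex μ N t} ⊆ C}

theorem measurableSet_innerCells (N : ℕ) (C : Set ℝ) : MeasurableSet (innerCells μ N C) :=
  measurable_cellIndex (μ := μ) N (Set.to_countable {c | cellIndex μ N ⁻¹' {c} ⊆ C}).measurableSet

omit [IsProbabilityMeasure μ] in
theorem innerCells_subset (N : ℕ) (C : Set ℝ) : innerCells μ N C ⊆ C := fun _ ht => ht rfl

omit [IsProbabilityMeasure μ] in
theorem innerCells_subset_innerCells (N : ℕ) (C : Set ℝ) :
    innerCells μ N C ⊆ innerCells μ (N * 2) C := fun t ht s hs => by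
  refine ht ?_
  have hs' : cellIndex μ (N * 2) s = cellIndex μ (N * 2) t := hs
  simp only [Set.mem_preimage, Set.mem_singleton_iff]
  rw [← cellIndex_two_mul N, ← cellIndex_two_mul N, hs']

/-- A cell that meets `C` without lying in it must contain a point of `B`, since cells are
intervals. -/
theorem cellIndex_mem_image {B : Finset ℝ} {C : Set ℝ} (hB : CutBy B C) {N : ℕ} {t : ℝ}
    (ht : t ∈ C \ innerCells μ N C) : cellIndex μ N t ∈ B.image (cellIndex μ N) := by
  by_contra hnot
  rcases hB _ (ordConnected_cell (μ := μ) N (cellIndex μ N t)) (by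
    rw [Set.disjoint_left]
    intro b hb hbB
    exact hnot (Finset.mem_image.2 ⟨b, hbB, hb⟩)) with h | h
  · exact ht.2 h
  · exact Set.disjoint_left.1 h rfl ht.1

theorem abs_empDev_le_sum {N : ℕ} {S : Set ℝ} (σ : Finset ℕ) (hS : S = cellIndex μ N ⁻¹' σ)
    (x : Fin n → ℝ) : |empDev μ x S| ≤ ∑ c ∈ σ, |empDev μ x (cellIndex μ N ⁻¹' {c})| := by
  rw [hS, empDev_preimage (measurable_cellIndex N)]
  exact Finset.abs_sum_le_sum_abs _ _

theorem abs_empDev_innerCells_zero {m : ℕ} (hm : 1 ≤ m) {τ : ℝ} (hτ : 0 < τ) (x : Fin n → ℝ)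
    (C : Set ℝ) : |empDev μ x (innerCells μ (m * 2 ^ 0) C)| ≤ levelBound μ m 0 τ x := by
  classical
  set σ := (Finset.range (m * 2 ^ 0 + 1)).filter
    fun c => cellIndex μ (m * 2 ^ 0) ⁻¹' {c} ⊆ C
  refine (abs_empDev_le_sum σ ?_ x).trans
    (sum_abs_empDev_le_levelBound hτ x (Finset.filter_subset _ _) ?_)
  · ext t
    simp only [innerCells, Set.mem_ofPred_eq, Set.mem_preimage, Finset.mem_coe, σ,
      Finset.mem_filter, Finset.mem_range, cellIndex_lt, true_and]
  -- Level 0 has `m + 1` cells, not `m`, because the distribution function may reach 1; `m + 1 ≤ 2 *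
  -- m` uses `1 ≤ m`.
  · refine (Finset.card_filter_le _ _).trans ?_
    simp
    omega

/-- The cells gained by one refinement are halves of cells that contain a point of `B`, so there are
at most `2 * m` of them. -/
theorem abs_empDev_innerCells_diff {m : ℕ} {B : Finset ℝ} {C : Set ℝ} (hB : CutBy B C)
    (hBm : B.card ≤ m) (i : ℕ) {τ : ℝ} (hτ : 0 < τ) (x : Fin n → ℝ) :
    |empDev μ x (innerCells μ (m * 2 ^ (i + 1)) C \ innerCells μ (m * 2 ^ i) C)|
      ≤ levelBound μ m (i + 1) τ x := by
  classical
  have hN : m * 2 ^ (i + 1) = m * 2 ^ i * 2 := by rw [pow_succ, mul_assoc]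
  set N := m * 2 ^ i with hNdef
  set S := innerCells μ (m * 2 ^ (i + 1)) C \ innerCells μ N C with hS
  set β := B.image (cellIndex μ N)
  set σ := (Finset.range (m * 2 ^ (i + 1) + 1)).filter
    fun c => ∃ t ∈ S, cellIndex μ (m * 2 ^ (i + 1)) t = c
  refine (abs_empDev_le_sum σ ?_ x).trans
    (sum_abs_empDev_le_levelBound hτ x (Finset.filter_subset _ _) ?_)
  · ext t
    simp only [Set.mem_preimage, Finset.mem_coe, σ, Finset.mem_filter, Finset.mem_range,
      cellIndex_lt, true_and]
    refine ⟨fun ht => ⟨t, ht, rfl⟩, ?_⟩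
    rintro ⟨s, hs, hst⟩
    have hst' : cellIndex μ N s = cellIndex μ N t := by
      rw [← cellIndex_two_mul N, ← cellIndex_two_mul N, ← hN, hst]
    simpa only [hS, innerCells, Set.mem_sdiff, Set.mem_ofPred_eq, hst, hst'] using hs
  · have hsub : σ ⊆ β.biUnion fun d => {2 * d, 2 * d + 1} := by
      intro c hc
      obtain ⟨-, t, ht, htc⟩ := Finset.mem_filter.1 hc
      have h1 := cellIndex_mem_image hB ⟨innerCells_subset _ _ ht.1, ht.2⟩
      rw [← cellIndex_two_mul, ← hN, htc] at h1
      simp only [Finset.mem_biUnion, Finset.mem_insert, Finset.mem_singleton]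
      exact ⟨_, h1, by omega⟩
    refine (Finset.card_le_card hsub).trans ?_
    refine (Finset.card_biUnion_le_card_mul _ _ 2 fun d _ => Finset.card_le_two).trans ?_
    have : β.card ≤ B.card := Finset.card_image_le
    omega

theorem abs_empDev_innerCells_le {m : ℕ} (hm : 1 ≤ m) {B : Finset ℝ} {C : Set ℝ} (hB : CutBy B C)
    (hBm : B.card ≤ m) {τ : ℕ → ℝ} (hτ : ∀ i, 0 < τ i) (x : Fin n → ℝ) (k : ℕ) :
    |empDev μ x (innerCells μ (m * 2 ^ k) C)|
      ≤ ∑ i ∈ Finset.range (k + 1), levelBound μ m i (τ i) x := by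
  induction k with
  | zero => simpa using abs_empDev_innerCells_zero hm (hτ 0) x C
  | succ k ih =>
    rw [Finset.sum_range_succ]
    have hsub : innerCells μ (m * 2 ^ k) C ⊆ innerCells μ (m * 2 ^ (k + 1)) C := by
      rw [pow_succ, ← mul_assoc]
      exact innerCells_subset_innerCells _ _
    have h := empDev_union (μ := μ) ((measurableSet_innerCells (μ := μ) (m * 2 ^ (k + 1)) C).diff
      (measurableSet_innerCells (μ := μ) (m * 2 ^ k) C)) Set.disjoint_sdiff_right x
    rw [Set.union_sdiff_cancel hsub] at h
    rw [h]
    exact (abs_add_le _ _).trans (add_le_add ih (abs_empDev_innerCells_diff hB hBm k (hτ _) x))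

theorem abs_empDev_le_of_subset {S T : Set ℝ} (h : S ⊆ T) (x : Fin n → ℝ) :
    |empDev μ x S| ≤ |empDev μ x T| + μ.real T := by
  have h1 : ∑ i, S.indicator (1 : ℝ → ℝ) (x i) ≤ ∑ i, T.indicator (1 : ℝ → ℝ) (x i) :=
    Finset.sum_le_sum fun i _ =>
      Set.indicator_le_indicator_of_subset h (fun _ => zero_le_one) _
  have h2 : 0 ≤ (∑ i, S.indicator (1 : ℝ → ℝ) (x i)) / n :=
    div_nonneg (Finset.sum_nonneg fun i _ => Set.indicator_nonneg (fun _ _ => zero_le_one) _)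
      (Nat.cast_nonneg _)
  have h3 : (∑ i, S.indicator (1 : ℝ → ℝ) (x i)) / n ≤ (∑ i, T.indicator (1 : ℝ → ℝ) (x i)) / n := by
    gcongr
  have h4 : μ.real S ≤ μ.real T := measureReal_mono h
  have h5 : 0 ≤ μ.real S := measureReal_nonneg
  have h6 := le_abs_self (empDev μ x T)
  have h7 := abs_nonneg (empDev μ x T)
  unfold empDev at *
  rw [abs_le]
  constructor <;> linarith

/-- The total chaining bound, down to the level `J`. -/
def chainBound {n : ℕ} (μ : Measure ℝ) (m J : ℕ) (τ : ℕ → ℝ) (x : Fin n → ℝ) : ℝ :=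
  ∑ i ∈ Finset.range (J + 1), levelBound μ m i (τ i) x + levelBound μ m J (τ J) x + 1 / 2 ^ J

/-- What the inner cells of level `J` miss lies in at most `m` cells of mass at most `1 / (m 2 ^
J)`. Enlarging it to their union costs that mass, hence the extra `1 / 2 ^ J`. -/
theorem abs_empDev_le_chainBound [NullSingletonClass μ] {m : ℕ} (hm : 1 ≤ m) {B : Finset ℝ} {C : Set ℝ}
    (hC : MeasurableSet C) (hB : CutBy B C) (hBm : B.card ≤ m) {τ : ℕ → ℝ} (hτ : ∀ i, 0 < τ i)
    (x : Fin n → ℝ) (J : ℕ) : |empDev μ x C| ≤ chainBound μ m J τ x := by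
  classical
  set N := m * 2 ^ J
  set β := B.image (cellIndex μ N)
  have hβ : β.card ≤ m := Finset.card_image_le.trans hBm
  have hN : 1 ≤ N := Nat.mul_pos hm (by positivity)
  have h := empDev_union (μ := μ) (hC.diff (measurableSet_innerCells (μ := μ) N C))
    Set.disjoint_sdiff_right x
  rw [Set.union_sdiff_cancel (innerCells_subset _ _)] at h
  have hsub : C \ innerCells μ N C ⊆ cellIndex μ N ⁻¹' β := fun t ht =>
    cellIndex_mem_image hB ht
  have h1 : |empDev μ x (cellIndex μ N ⁻¹' β)| ≤ levelBound μ m J (τ J) x := by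
    refine (abs_empDev_le_sum β rfl x).trans
      (sum_abs_empDev_le_levelBound (hτ J) x ?_ (by omega))
    intro c hc
    obtain ⟨b, -, rfl⟩ := Finset.mem_image.1 hc
    exact Finset.mem_range.2 (cellIndex_lt _ _)
  have h2 : μ.real (cellIndex μ N ⁻¹' β) ≤ 1 / 2 ^ J := by
    have : cellIndex μ N ⁻¹' β = ⋃ c ∈ β, cellIndex μ N ⁻¹' {c} := by ext t; simp
    rw [this]
    refine (measureReal_biUnion_finset_le _ _).trans ?_
    refine (Finset.sum_le_sum fun c _ => measureReal_cell_le hN c).trans ?_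
    rw [Finset.sum_const, nsmul_eq_mul]
    have hm' : (0 : ℝ) < m := by exact_mod_cast hm
    have hβ' : (β.card : ℝ) ≤ m := by exact_mod_cast hβ
    calc (β.card : ℝ) * (1 / (N : ℝ)) ≤ m * (1 / (N : ℝ)) := by gcongr
      _ = 1 / 2 ^ J := by simp only [N]; push_cast; field_simp
  have h3 := abs_empDev_le_of_subset (μ := μ) hsub x
  have h4 := abs_empDev_innerCells_le (μ := μ) hm hB hBm hτ x J
  rw [h, chainBound]
  refine (abs_add_le _ _).trans ?_
  linarith

end Chaining

/-! ### The expectation of the chaining bound -/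

section Expectation

variable {n : ℕ} {μ : Measure ℝ} [IsProbabilityMeasure μ]

theorem integrable_levelBound (hn : 1 ≤ n) (m i : ℕ) (τ : ℝ) :
    Integrable (fun x : Fin n → ℝ => levelBound μ m i τ x) (Measure.pi fun _ => μ) := by
  unfold levelBound
  refine (integrable_const _).add ((integrable_finsetSum _ fun c _ => ?_).div_const _)
  refine Integrable.of_bound ((measurable_empDev (measurable_cellIndex _
    (measurableSet_singleton c))).pow_const 4).aestronglyMeasurable 1
    (Filter.Eventually.of_forall fun x => ?_)
  rw [norm_pow]
  exact pow_le_one₀ (norm_nonneg _) (abs_empDev_le hn x _)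

theorem integral_levelBound_le [NullSingletonClass μ] {m i : ℕ} (hm : 1 ≤ m) (hmn : m * 2 ^ i ≤ n) {τ : ℝ}
    (hτ : 0 < τ) :
    ∫ x : Fin n → ℝ, levelBound μ m i τ x ∂(Measure.pi fun _ => μ)
      ≤ 3 / 2 * m * τ + 2 / (m * 2 ^ i * n ^ 2 * τ ^ 3) := by
  set N := m * 2 ^ i with hN
  have hN1 : 1 ≤ N := Nat.mul_pos hm (by positivity)
  have hn : 1 ≤ n := hN1.trans hmn
  have hN0 : (1 : ℝ) ≤ N := by exact_mod_cast hN1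
  have hn0 : (0 : ℝ) < n := by exact_mod_cast hn
  have hNn : (N : ℝ) ≤ n := by exact_mod_cast hmn
  have hint : ∀ c, Integrable (fun x : Fin n → ℝ => empDev μ x (cellIndex μ N ⁻¹' {c}) ^ 4)
      (Measure.pi fun _ => μ) := fun c => by
    refine Integrable.of_bound ((measurable_empDev (measurable_cellIndex _
      (measurableSet_singleton c))).pow_const 4).aestronglyMeasurable 1
      (Filter.Eventually.of_forall fun x => ?_)
    rw [norm_pow]
    exact pow_le_one₀ (norm_nonneg _) (abs_empDev_le hn x _)
  have hsum : ∑ c ∈ Finset.range (N + 1), ∫ x : Fin n → ℝ,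
      empDev μ x (cellIndex μ N ⁻¹' {c}) ^ 4 ∂(Measure.pi fun _ => μ)
      ≤ (N + 1) * (4 * (1 / N) ^ 2 / n ^ 2) := by
    refine (Finset.sum_le_sum fun c _ => integral_empDev_pow_four_le hn
      (measurable_cellIndex N (measurableSet_singleton c)) (measureReal_cell_le hN1 c) ?_).trans ?_
    · rw [mul_one_div, le_div_iff₀ (by linarith)]; linarith
    · simp
  unfold levelBound
  rw [← hN, integral_add (integrable_const _)
    ((integrable_finsetSum _ fun c _ => hint c).div_const _), integral_div,
    integral_finsetSum _ fun c _ => hint c]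
  simp only [integral_const, probReal_univ, one_smul]
  refine add_le_add_right ?_ _
  calc _ ≤ ((N + 1) * (4 * (1 / N) ^ 2 / n ^ 2)) / (4 * τ ^ 3) := by gcongr
    _ ≤ ((2 * N) * (4 * (1 / N) ^ 2 / n ^ 2)) / (4 * τ ^ 3) := by gcongr; linarith
    _ = 2 / (N * n ^ 2 * τ ^ 3) := by field_simp
    _ = _ := by rw [hN]; push_cast; rfl

/-- The scales used in the chaining bound. -/
def chainScale (m n i : ℕ) : ℝ := 3 / 2 * (5 / 6) ^ i / √(m * n)

theorem chainScale_pos {m n : ℕ} (hm : 1 ≤ m) (hn : 1 ≤ n) (i : ℕ) : 0 < chainScale m n i := by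
  have : (0 : ℝ) < m := by exact_mod_cast hm
  have : (0 : ℝ) < n := by exact_mod_cast hn
  unfold chainScale
  positivity

/-- The ratio `r = 5 / 6` of the scales satisfies both `r < 1` and `2 r ^ 3 > 1`, so both terms
decay geometrically; `108 / 125` is `1 / (2 r ^ 3)`. -/
theorem integral_levelBound_chainScale_le [NullSingletonClass μ] {m i : ℕ} (hm : 1 ≤ m)
    (hmn : m * 2 ^ i ≤ n) :
    ∫ x : Fin n → ℝ, levelBound μ m i (chainScale m n i) x ∂(Measure.pi fun _ => μ)
      ≤ √(m / n) * (9 / 4 * (5 / 6) ^ i + 16 / 27 * (108 / 125) ^ i) := by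
  have hn : 1 ≤ n := (Nat.mul_pos hm (pow_pos two_pos i)).trans_le hmn
  have hm0 : (0 : ℝ) < m := by exact_mod_cast hm
  have hn0 : (0 : ℝ) < n := by exact_mod_cast hn
  refine (integral_levelBound_le hm hmn (chainScale_pos hm hn i)).trans (le_of_eq ?_)
  unfold chainScale
  rw [Real.sqrt_div hm0.le, Real.sqrt_mul hm0.le]
  obtain ⟨a, ha, ha'⟩ : ∃ a : ℝ, 0 < a ∧ (m : ℝ) = a ^ 2 := ⟨√m, by positivity, by simp⟩
  obtain ⟨b, hb, hb'⟩ : ∃ b : ℝ, 0 < b ∧ (n : ℝ) = b ^ 2 := ⟨√n, by positivity, by simp⟩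
  rw [ha', hb', Real.sqrt_sq ha.le, Real.sqrt_sq hb.le]
  have e : ((108 : ℝ) / 125) ^ i = 1 / (2 ^ i * ((5 / 6) ^ i) ^ 3) := by
    rw [← pow_mul, mul_comm i 3, pow_mul, ← mul_pow, ← one_div_pow]
    norm_num
  rw [e]
  field_simp
  ring

theorem integrable_chainBound (hn : 1 ≤ n) (m J : ℕ) (τ : ℕ → ℝ) :
    Integrable (fun x : Fin n → ℝ => chainBound μ m J τ x) (Measure.pi fun _ => μ) := by
  unfold chainBound
  exact ((integrable_finsetSum _ fun i _ => integrable_levelBound hn m i _).add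
    (integrable_levelBound hn m J _)).add (integrable_const _)

theorem exists_uniform_empDev_bound [NullSingletonClass μ] {m : ℕ} (hm : 1 ≤ m) (hmn : m ≤ n) :
    ∃ U : (Fin n → ℝ) → ℝ, Integrable U (Measure.pi fun _ => μ) ∧
      ∫ x, U x ∂(Measure.pi fun _ => μ) ≤ 26 * √(m / n) ∧
      ∀ (B : Finset ℝ) (C : Set ℝ), MeasurableSet C → CutBy B C → B.card ≤ m →
        ∀ x, |empDev μ x C| ≤ U x := by
  have hn : 1 ≤ n := hm.trans hmn
  have hm0 : (0 : ℝ) < m := by exact_mod_cast hm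
  have hn0 : (0 : ℝ) < n := by exact_mod_cast hn
  -- The last level has `m 2 ^ J ≤ n < m 2 ^ (J + 1)`: cells still have mass bound `1 / (m 2 ^ J) ≥
  -- 1 / n`, as the fourth moment estimate requires, while the remainder `1 / 2 ^ J` is at most `2 m
  -- / n`.
  set J := Nat.log 2 (n / m) with hJ
  have hq : n / m ≠ 0 := (Nat.div_pos hmn hm).ne'
  have hJ1 : m * 2 ^ J ≤ n := by
    have := Nat.pow_log_le_self 2 hq
    exact (Nat.mul_le_mul_left m this).trans (Nat.mul_div_le n m)
  have hJ2 : n < m * 2 ^ (J + 1) := by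
    have := Nat.lt_pow_succ_log_self (b := 2) (by norm_num) (n / m)
    rw [mul_comm]
    exact (Nat.div_lt_iff_lt_mul hm).1 this
  set s := √((m : ℝ) / n) with hs
  have hs0 : 0 < s := by positivity
  have hs1 : s ≤ 1 := by
    rw [hs, Real.sqrt_le_one, div_le_one hn0]
    exact_mod_cast hmn
  have hss : s ^ 2 = m / n := Real.sq_sqrt (by positivity)
  refine ⟨chainBound μ m J (chainScale m n), integrable_chainBound hn m J _, ?_,
    fun B C hC hB hBm x => abs_empDev_le_chainBound hm hC hB hBm (chainScale_pos hm hn) x J⟩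
  have hlev : ∀ i ≤ J, ∫ x : Fin n → ℝ, levelBound μ m i (chainScale m n i) x
      ∂(Measure.pi fun _ => μ) ≤ s * (9 / 4 * (5 / 6) ^ i + 16 / 27 * (108 / 125) ^ i) :=
    fun i hi => integral_levelBound_chainScale_le hm
      ((Nat.mul_le_mul_left m (Nat.pow_le_pow_right (by norm_num) hi)).trans hJ1)
  have hg : ∀ {r : ℝ}, 0 ≤ r → r < 1 → ∑ i ∈ Finset.range (J + 1), r ^ i ≤ 1 / (1 - r) := by
    intro r h0 h1
    rw [geom_sum_eq h1.ne, ← neg_div_neg_eq]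
    have : 0 < 1 - r := by linarith
    have : 0 ≤ r ^ (J + 1) := by positivity
    rw [neg_sub, neg_sub]
    gcongr
    linarith
  have hJ3 : (1 : ℝ) / 2 ^ J ≤ 2 * s := by
    have : (n : ℝ) < m * 2 ^ (J + 1) := by exact_mod_cast hJ2
    have h2 : (1 : ℝ) / 2 ^ J ≤ 2 * (m / n) := by
      rw [div_le_iff₀ (by positivity)]
      rw [pow_succ] at this
      field_simp
      nlinarith
    rw [← hss] at h2
    nlinarith
  have i1 : Integrable (fun x : Fin n → ℝ => ∑ i ∈ Finset.range (J + 1),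
      levelBound μ m i (chainScale m n i) x) (Measure.pi fun _ => μ) :=
    integrable_finsetSum _ fun i _ => integrable_levelBound hn m i _
  have i2 := integrable_levelBound (μ := μ) hn m J (chainScale m n J)
  unfold chainBound
  rw [integral_add (i1.fun_add i2) (integrable_const _), integral_add i1 i2,
    integral_finsetSum _ fun i _ => integrable_levelBound hn m i _]
  have hsum : ∑ i ∈ Finset.range (J + 1), ∫ x : Fin n → ℝ, levelBound μ m i (chainScale m n i) x
      ∂(Measure.pi fun _ => μ) ≤ s * (9 / 4 * 6 + 16 / 27 * (125 / 17)) := by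
    refine (Finset.sum_le_sum fun i hi =>
      hlev i (Nat.lt_succ_iff.1 (Finset.mem_range.1 hi))).trans ?_
    rw [← Finset.mul_sum, Finset.sum_add_distrib, ← Finset.mul_sum, ← Finset.mul_sum]
    have h1 := hg (r := 5 / 6) (by norm_num) (by norm_num)
    have h2 := hg (r := 108 / 125) (by norm_num) (by norm_num)
    norm_num at h1 h2
    gcongr
  have hlast := hlev J le_rfl
  have p1 : ((5 : ℝ) / 6) ^ J ≤ 1 := pow_le_one₀ (by norm_num) (by norm_num)
  have p2 : ((108 : ℝ) / 125) ^ J ≤ 1 := pow_le_one₀ (by norm_num) (by norm_num)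
  have hlast' : s * (9 / 4 * (5 / 6) ^ J + 16 / 27 * (108 / 125) ^ J) ≤ s * (9 / 4 + 16 / 27) := by
    exact mul_le_mul_of_nonneg_left (by linarith) hs0.le
  simp only [integral_const, probReal_univ, one_smul]
  linarith

end Expectation

/-! ### Sign changes of piecewise convex-concave functions -/

theorem exists_pieces_subset {A : Finset ℝ} {G : Set ℝ} (hG : G.OrdConnected)
    (hGA : Disjoint G A) (hne : G.Nonempty) : ∃ I ∈ pieces A, G ⊆ I := by
  obtain ⟨x, hx⟩ := hne
  refine ⟨_, ⟨x, Set.disjoint_left.1 hGA hx, rfl⟩, fun y hy => ?_⟩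
  exact fun z hz => Set.disjoint_left.1 hGA (hG.uIcc_subset hx hy hz)

/-- If `S` is unbounded on a side, the default value of `sInf` or `sSup` is a harmless extra point:
an endpoint is used only when a point outside `S` bounds `S` on that side. -/
theorem cutBy_sInf_sSup {S : Set ℝ} (hS : S.OrdConnected) : CutBy {sInf S, sSup S} S := by
  intro I hI hdis
  by_contra! hcon
  obtain ⟨h1, h2⟩ := hcon
  obtain ⟨y, hyI, hyS⟩ := Set.not_subset.1 h1
  obtain ⟨x, hxI, hxS⟩ := Set.not_disjoint_iff.1 h2
  have hne : S.Nonempty := ⟨x, hxS⟩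
  rcases lt_trichotomy y x with h | h | h
  · have hlb : y ∈ lowerBounds S := fun s hs => by
      by_contra! hsy
      exact hyS (hS.out hs hxS ⟨hsy.le, h.le⟩)
    have : sInf S ∈ I := hI.out hyI hxI ⟨le_csInf hne hlb, csInf_le ⟨y, hlb⟩ hxS⟩
    exact Set.disjoint_left.1 hdis this (by simp)
  · exact hyS (h ▸ hxS)
  · have hub : y ∈ upperBounds S := fun s hs => by
      by_contra! hsy
      exact hyS (hS.out hxS hs ⟨h.le, hsy.le⟩)
    have : sSup S ∈ I := hI.out hxI hyI ⟨le_csSup ⟨y, hub⟩ hxS, csSup_le hne hub⟩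
    exact Set.disjoint_left.1 hdis this (by simp)

/-- For convex `h` the set `{h ≤ 0}` is an interval of `G`, for concave `h` the set `{0 < h}` is;
the two endpoints of that interval do the cutting. -/
theorem exists_cut_pos_of_convex_or_concave {G : Set ℝ} {h : ℝ → ℝ}
    (hh : IsConvexConcaveOn h G) : ∃ B : Finset ℝ, B.card ≤ 2 ∧
      ∀ I : Set ℝ, I.OrdConnected → I ⊆ G → Disjoint I B →
        I ⊆ {x | 0 < h x} ∨ Disjoint I {x | 0 < h x} := by
  classical
  rcases hh with hh | hh
  · refine ⟨{sInf {x ∈ G | h x ≤ 0}, sSup {x ∈ G | h x ≤ 0}}, Finset.card_le_two,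
      fun I hI hIG hdis => ?_⟩
    rcases cutBy_sInf_sSup (hh.convex_le 0).ordConnected I hI hdis with h1 | h1
    · exact Or.inr (Set.disjoint_left.2 fun x hx hx' => absurd (h1 hx).2 (not_le.2 hx'))
    · refine Or.inl fun x hx => ?_
      by_contra hcon
      exact Set.disjoint_left.1 h1 hx ⟨hIG hx, not_lt.1 hcon⟩
  · refine ⟨{sInf {x ∈ G | 0 < h x}, sSup {x ∈ G | 0 < h x}}, Finset.card_le_two,
      fun I hI hIG hdis => ?_⟩
    rcases cutBy_sInf_sSup (hh.convex_gt 0).ordConnected I hI hdis with h1 | h1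
    · exact Or.inl fun x hx => (h1 hx).2
    · exact Or.inr (Set.disjoint_left.2 fun x hx hx' => Set.disjoint_left.1 h1 hx ⟨hIG hx, hx'⟩)

theorem exists_cutBy_pos {E : Finset ℝ} {h : ℝ → ℝ}
    (hh : ∀ G : Set ℝ, G.OrdConnected → G.Nonempty → Disjoint G E → IsConvexConcaveOn h G) :
    ∃ B : Finset ℝ, B.card ≤ 3 * E.card + 2 ∧ CutBy B {x | 0 < h x} := by
  classical
  -- The number of points of `E` to the left labels the gaps of `E`, which are thus at most `E.card
  -- + 1`; each contributes two cut points besides `E` itself.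
  set cnt : ℝ → ℕ := fun x => (E.filter (· < x)).card with hcnt
  have hmono : Monotone cnt := fun x y hxy => Finset.card_le_card fun e he => by
    simp only [Finset.mem_filter] at he ⊢
    exact ⟨he.1, he.2.trans_le hxy⟩
  set G : ℕ → Set ℝ := fun k => {x | x ∉ E ∧ cnt x = k} with hG
  have hGo : ∀ k, (G k).OrdConnected := fun k => by
    refine ⟨fun x hx y hy z hz => ⟨fun hzE => ?_, ?_⟩⟩
    · have hzy : z < y := lt_of_le_of_ne hz.2 fun h => hy.1 (h ▸ hzE)
      have : cnt x < cnt y := by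
        refine Finset.card_lt_card (Finset.ssubset_iff_of_subset ?_ |>.2 ⟨z, ?_, ?_⟩)
        · intro e he
          simp only [Finset.mem_filter] at he ⊢
          exact ⟨he.1, he.2.trans (hz.1.trans_lt hzy)⟩
        · simp [hzE, hzy]
        · simp [hz.1]
      rw [hx.2, hy.2] at this
      exact lt_irrefl _ this
    · exact le_antisymm ((hmono hz.2).trans_eq hy.2) (hx.2.symm.trans_le (hmono hz.1))
  have hGE : ∀ k, Disjoint (G k) E := fun k => Set.disjoint_left.2 fun x hx => hx.1
  have hex : ∀ k, ∃ B : Finset ℝ, B.card ≤ 2 ∧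
      ∀ I : Set ℝ, I.OrdConnected → I ⊆ G k → Disjoint I B →
        I ⊆ {x | 0 < h x} ∨ Disjoint I {x | 0 < h x} := fun k => by
    rcases (G k).eq_empty_or_nonempty with h0 | hne
    · exact ⟨∅, by simp, fun I _ hI _ => Or.inl ((hI.trans h0.le).trans (Set.empty_subset _))⟩
    · exact exists_cut_pos_of_convex_or_concave (hh _ (hGo k) hne (hGE k))
  choose B hBc hB using hex
  refine ⟨E ∪ (Finset.range (E.card + 1)).biUnion B, ?_, fun I hI hdis => ?_⟩
  · refine (Finset.card_union_le _ _).trans ?_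
    have := Finset.card_biUnion_le_card_mul (Finset.range (E.card + 1)) B 2 fun k _ => hBc k
    rw [Finset.card_range] at this
    omega
  · rcases I.eq_empty_or_nonempty with rfl | ⟨x, hx⟩
    · exact Or.inl (Set.empty_subset _)
    rw [Set.disjoint_left] at hdis
    simp only [Finset.coe_union, Set.mem_union, not_or, Finset.mem_coe, Finset.mem_biUnion,
      Finset.mem_range, not_exists, not_and] at hdis
    have hIG : I ⊆ G (cnt x) := fun y hy => by
      refine ⟨(hdis hy).1, ?_⟩
      simp only [hcnt]
      congr 1
      refine Finset.filter_congr fun e he => ⟨fun h1 => ?_, fun h1 => ?_⟩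
      · by_contra! h2
        exact (hdis (hI.out hx hy ⟨h2, h1.le⟩)).1 he
      · by_contra! h2
        exact (hdis (hI.out hy hx ⟨h2, h1.le⟩)).1 he
    refine hB (cnt x) I hI hIG (Set.disjoint_left.2 fun y hy => (hdis hy).2 _ ?_)
    exact Nat.lt_succ_of_le (Finset.card_filter_le _ _)

theorem IsConvexConcaveOn.mono {g : ℝ → ℝ} {I J : Set ℝ} (h : IsConvexConcaveOn g I)
    (hJI : J ⊆ I) (hJ : J.OrdConnected) : IsConvexConcaveOn g J :=
  h.imp (fun h => h.subset hJI hJ.convex) fun h => h.subset hJI hJ.convex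

theorem isConvexConcaveOn_sub_affine {p q : ℝ → ℝ} {A B : Finset ℝ}
    (hq : ∀ I ∈ pieces A, IsConvexConcaveOn q I)
    (hp : ∀ I ∈ pieces B, ∃ a b : ℝ, ∀ x ∈ I, p x = a * x + b)
    {G : Set ℝ} (hG : G.OrdConnected) (hne : G.Nonempty) (hdis : Disjoint G (A ∪ B : Finset ℝ)) :
    IsConvexConcaveOn (fun x => q x - p x) G ∧ IsConvexConcaveOn (fun x => p x - q x) G := by
  have hdA : Disjoint G A := hdis.mono_right (by simp)
  have hdB : Disjoint G B := hdis.mono_right (by simp)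
  obtain ⟨I, hI, hGI⟩ := exists_pieces_subset hG hdA hne
  obtain ⟨J, hJ, hGJ⟩ := exists_pieces_subset hG hdB hne
  obtain ⟨a, b, hab⟩ := hp J hJ
  have hcx : ConvexOn ℝ G p := ⟨hG.convex, fun x hx y hy s t hs ht hst => by
    rw [hab _ (hGJ hx), hab _ (hGJ hy), hab _ (hGJ (hG.convex hx hy hs ht hst))]
    simp only [smul_eq_mul]
    have : t = 1 - s := by linarith
    subst this
    exact le_of_eq (by ring)⟩
  have hcv : ConcaveOn ℝ G p := ⟨hG.convex, fun x hx y hy s t hs ht hst => by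
    rw [hab _ (hGJ hx), hab _ (hGJ hy), hab _ (hGJ (hG.convex hx hy hs ht hst))]
    simp only [smul_eq_mul]
    have : t = 1 - s := by linarith
    subst this
    exact le_of_eq (by ring)⟩
  rcases (hq I hI).mono hGI hG with h | h
  · exact ⟨Or.inl (h.sub hcv), Or.inr (hcv.sub h)⟩
  · exact ⟨Or.inr (h.sub hcx), Or.inl (hcx.sub h)⟩

theorem exists_cutBy_lt {D : ℕ} {p q : ℝ → ℝ} (hq : q ∈ Mbar 4) (hp : p ∈ Obar D 4) :
    (∃ B : Finset ℝ, B.card ≤ 3 * D + 14 ∧ CutBy B {x | p x < q x}) ∧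
      ∃ B : Finset ℝ, B.card ≤ 3 * D + 14 ∧ CutBy B {x | q x < p x} := by
  classical
  obtain ⟨-, A, -, hAc, hA⟩ := hq
  obtain ⟨-, -, E, -, hEc, hE⟩ := hp
  have hc : (A ∪ E).card ≤ D + 4 := (Finset.card_union_le _ _).trans (by omega)
  have key := fun (G : Set ℝ) (hG : G.OrdConnected) hne hdis =>
    isConvexConcaveOn_sub_affine (G := G) (fun I hI => (hA I hI).2) hE hG hne hdis
  constructor
  · obtain ⟨B, hBc, hB⟩ := exists_cutBy_pos fun G hG hne hdis => (key G hG hne hdis).1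
    exact ⟨B, by omega, by simpa only [sub_pos] using hB⟩
  · obtain ⟨B, hBc, hB⟩ := exists_cutBy_pos fun G hG hne hdis => (key G hG hne hdis).2
    exact ⟨B, by omega, by simpa only [sub_pos] using hB⟩

/-! ### Piecewise affine majorants of a concave function -/

section Majorants

variable {f : ℝ → ℝ} {a b : ℝ}

theorem chord_le_of_concaveOn (hf : ConcaveOn ℝ (Set.Icc a b) f) {s t c : ℝ} (has : a ≤ s)
    (htb : t ≤ b) (hst : s < t) (hc : f t = f s + c * (t - s)) {x : ℝ} (hx : x ∈ Set.Icc s t) :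
    f s + c * (x - s) ≤ f x := by
  have hs : s ∈ Set.Icc a b := ⟨has, hst.le.trans htb⟩
  have ht : t ∈ Set.Icc a b := ⟨has.trans hst.le, htb⟩
  have hpos : 0 < t - s := by linarith
  have h := hf.2 hs ht
    (show 0 ≤ (t - x) / (t - s) from div_nonneg (by linarith [hx.2]) hpos.le)
    (show 0 ≤ (x - s) / (t - s) from div_nonneg (by linarith [hx.1]) hpos.le)
    (by field_simp; ring)
  simp only [smul_eq_mul] at h
  rw [hc] at h
  have e1 : (t - x) / (t - s) * s + (x - s) / (t - s) * t = x := by field_simp; ring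
  have e2 : (t - x) / (t - s) * f s + (x - s) / (t - s) * (f s + c * (t - s))
    = f s + c * (x - s) := by field_simp; ring
  rwa [e1, e2] at h

theorem exists_tangent_parallel_chord (hf : ConcaveOn ℝ (Set.Icc a b) f)
    (hcont : ContinuousOn f (Set.Icc a b)) {s t c : ℝ} (has : a ≤ s) (htb : t ≤ b) (hst : s < t)
    (hc : f t = f s + c * (t - s)) :
    ∃ P ∈ Set.Ioo s t, ∀ x ∈ Set.Icc a b, f x ≤ f P + c * (x - P) := by
  set φ : ℝ → ℝ := fun x => f x - c * x with hφ
  have hsub : Set.Icc s t ⊆ Set.Icc a b := Set.Icc_subset_Icc has htb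
  have hφc : ConcaveOn ℝ (Set.Icc a b) φ := by
    refine hf.sub ⟨convex_Icc a b, fun x _ y _ u v _ _ _ => le_of_eq ?_⟩
    simp only [smul_eq_mul]
    ring
  have hφcont : ContinuousOn φ (Set.Icc s t) :=
    (hcont.mono hsub).sub (continuous_const.mul continuous_id).continuousOn
  obtain ⟨Q, hQ, hQmax⟩ := isCompact_Icc.exists_isMaxOn (Set.nonempty_Icc.2 hst.le) hφcont
  have hex : ∃ P ∈ Set.Ioo s t, ∀ x ∈ Set.Icc s t, φ x ≤ φ P := by
    by_cases hQi : Q ∈ Set.Ioo s t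
    · exact ⟨Q, hQi, hQmax⟩
    -- If the maximum is at an endpoint, the chord already attains it, so by concavity the midpoint
    -- attains it too.
    · have hmid : (s + t) / 2 ∈ Set.Ioo s t := ⟨by linarith, by linarith⟩
      refine ⟨_, hmid, fun x hx => (hQmax hx).trans ?_⟩
      have h1 := chord_le_of_concaveOn hf has htb hst hc (Set.Ioo_subset_Icc_self hmid)
      have hQ' : Q = s ∨ Q = t := by
        by_contra! h
        exact hQi ⟨lt_of_le_of_ne hQ.1 h.1.symm, lt_of_le_of_ne hQ.2 h.2⟩
      rcases hQ' with rfl | rfl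
      · simp only [hφ]; linarith
      · simp only [hφ]; rw [hc]; linarith
  obtain ⟨P, hP, hPmax⟩ := hex
  refine ⟨P, hP, fun x hx => ?_⟩
  have hloc : IsLocalMaxOn φ (Set.Icc a b) P := by
    refine Filter.Eventually.filter_mono nhdsWithin_le_nhds ?_
    filter_upwards [Icc_mem_nhds hP.1 hP.2] with z hz using hPmax z hz
  have := IsMaxOn.of_isLocalMaxOn_of_concaveOn (hsub (Set.Ioo_subset_Icc_self hP)) hloc hφc hx
  simp only [hφ, Set.mem_ofPred_eq] at this
  linarith

theorem integral_sub_le_of_le_triangle (hf : ConcaveOn ℝ (Set.Icc a b) f)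
    (hcont : ContinuousOn f (Set.Icc a b)) {s t x₀ y c : ℝ} (has : a ≤ s) (htb : t ≤ b)
    (hst : s ≤ t) (hc : f t = f s + c * (t - s)) {ψ : ℝ → ℝ} (hψ : ContinuousOn ψ (Set.Icc a b))
    (h1 : ∀ x ∈ Set.Icc s t, (ψ x - f s - c * (x - s)) * (x₀ - s) ≤ y * (x - s))
    (h2 : ∀ x ∈ Set.Icc s t, (ψ x - f s - c * (x - s)) * (t - x₀) ≤ y * (t - x)) :
    ∫ x in s..t, (ψ x - f x) ≤ (t - s) * y := by
  rcases hst.eq_or_lt with rfl | hst'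
  · simp
  have hsub : Set.Icc s t ⊆ Set.Icc a b := Set.Icc_subset_Icc has htb
  have hi : IntervalIntegrable (fun x => ψ x - f x) volume s t :=
    ((hψ.sub hcont).mono hsub).intervalIntegrable_of_Icc hst
  have h := intervalIntegral.integral_mono_on hst hi
    (intervalIntegrable_const (c := y)) fun x hx => by
      have h3 := chord_le_of_concaveOn hf has htb hst' hc hx
      have h4 := h1 x hx
      have h5 := h2 x hx
      have h6 : (ψ x - f s - c * (x - s)) * (t - s) ≤ y * (t - s) := by linarith
      have h7 := le_of_mul_le_mul_right h6 (by linarith)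
      linarith
  simpa using h

/-- The last two hypotheses on `l` say that, measured from the chord of slope `c`, it lies under the
triangle with base `[s, t]`, apex at `x₀` and height `y`. They are multiplied out so that `x₀` may
be an endpoint. The induction adds the tangent parallel to the chord and recurses on both sides of
the contact point `P`. -/
theorem exists_majorants (hf : ConcaveOn ℝ (Set.Icc a b) f)
    (hcont : ContinuousOn f (Set.Icc a b)) (L : ℕ) : ∀ (s t x₀ y c : ℝ) (l : ℝ → ℝ),
    a ≤ s → t ≤ b → s ≤ t → x₀ ∈ Set.Icc s t → 0 ≤ y → f t = f s + c * (t - s) →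
    (∀ x ∈ Set.Icc s t, f x ≤ l x) →
    (∀ x ∈ Set.Icc s t, (l x - f s - c * (x - s)) * (x₀ - s) ≤ y * (x - s)) →
    (∀ x ∈ Set.Icc s t, (l x - f s - c * (x - s)) * (t - x₀) ≤ y * (t - x)) →
    ∃ Λ : Finset (ℝ × ℝ), Λ.card + 1 ≤ 2 ^ L ∧
      (∀ d ∈ Λ, ∀ x ∈ Set.Icc a b, f x ≤ d.1 * x + d.2) ∧
      ∀ ψ : ℝ → ℝ, ContinuousOn ψ (Set.Icc a b) → (∀ x ∈ Set.Icc s t, ψ x ≤ l x) →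
        (∀ d ∈ Λ, ∀ x ∈ Set.Icc s t, ψ x ≤ d.1 * x + d.2) →
        ∫ x in s..t, (ψ x - f x) ≤ (t - s) * y / 4 ^ L := by
  classical
  have base : ∀ (s t x₀ y c : ℝ) (l ψ : ℝ → ℝ), a ≤ s → t ≤ b → s ≤ t → x₀ ∈ Set.Icc s t →
      f t = f s + c * (t - s) →
      (∀ x ∈ Set.Icc s t, (l x - f s - c * (x - s)) * (x₀ - s) ≤ y * (x - s)) →
      (∀ x ∈ Set.Icc s t, (l x - f s - c * (x - s)) * (t - x₀) ≤ y * (t - x)) →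
      ContinuousOn ψ (Set.Icc a b) → (∀ x ∈ Set.Icc s t, ψ x ≤ l x) →
      ∫ x in s..t, (ψ x - f x) ≤ (t - s) * y := by
    intro s t x₀ y c l ψ has htb hst hx₀ hc h1 h2 hψ hψl
    refine integral_sub_le_of_le_triangle hf hcont has htb hst hc hψ (x₀ := x₀)
      (fun x hx => le_trans ?_ (h1 x hx)) (fun x hx => le_trans ?_ (h2 x hx))
    · exact mul_le_mul_of_nonneg_right (by linarith [hψl x hx]) (by linarith [hx₀.1])
    · exact mul_le_mul_of_nonneg_right (by linarith [hψl x hx]) (by linarith [hx₀.2])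
  induction L with
  | zero =>
    intro s t x₀ y c l has htb hst hx₀ hy hc hfl h1 h2
    refine ⟨∅, by simp, by simp, fun ψ hψ hψl _ => ?_⟩
    simpa using base s t x₀ y c l ψ has htb hst hx₀ hc h1 h2 hψ hψl
  | succ L ih =>
    intro s t x₀ y c l has htb hst hx₀ hy hc hfl h1 h2
    rcases hst.eq_or_lt with rfl | hst'
    · exact ⟨∅, by simpa using Nat.one_le_two_pow, by simp, fun ψ _ _ _ => by simp⟩
    rcases hy.eq_or_lt with rfl | hy'
    · refine ⟨∅, by simpa using Nat.one_le_two_pow, by simp, fun ψ hψ hψl _ => ?_⟩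
      simpa using base s t x₀ 0 c l ψ has htb hst hx₀ hc h1 h2 hψ hψl
    obtain ⟨P, ⟨hsP, hPt⟩, hPtan⟩ := exists_tangent_parallel_chord hf hcont has htb hst' hc
    set M := f P - f s - c * (P - s) with hM
    have hPI : P ∈ Set.Icc s t := ⟨hsP.le, hPt.le⟩
    have hM0 : 0 ≤ M := by
      have := chord_le_of_concaveOn hf has htb hst' hc hPI
      simp only [hM]; linarith
    have hM1 : M * (x₀ - s) ≤ y * (P - s) := le_trans
      (mul_le_mul_of_nonneg_right (by simp only [hM]; linarith [hfl P hPI]) (by linarith [hx₀.1]))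
      (h1 P hPI)
    have hM2 : M * (t - x₀) ≤ y * (t - P) := le_trans
      (mul_le_mul_of_nonneg_right (by simp only [hM]; linarith [hfl P hPI]) (by linarith [hx₀.2]))
      (h2 P hPI)
    -- `r` is the relative height at which the tangent truncates the triangle.
    obtain ⟨r, hr⟩ : ∃ r, M = r * y := ⟨M / y, by field_simp⟩
    have hr0 : 0 ≤ r := by
      by_contra! h
      nlinarith
    have hu : 0 < P - s := by linarith
    have hv : 0 < t - P := by linarith
    have hr1 : r * (x₀ - s) ≤ P - s := by
      rw [hr] at hM1
      exact le_of_mul_le_mul_left (by linarith) hy'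
    have hr2 : r * (t - x₀) ≤ t - P := by
      rw [hr] at hM2
      exact le_of_mul_le_mul_left (by linarith) hy'
    have hx1 : 0 ≤ r * (x₀ - s) := mul_nonneg hr0 (by linarith [hx₀.1])
    have hx2 : 0 ≤ r * (t - x₀) := mul_nonneg hr0 (by linarith [hx₀.2])
    set l' : ℝ → ℝ := fun x => min (l x) (f P + c * (x - P)) with hl'
    have hl'M : ∀ x, l' x - f s - c * (x - s) ≤ M := fun x => by
      have := min_le_right (l x) (f P + c * (x - P))
      simp only [hl', hM]; linarith
    have hl'1 : ∀ x ∈ Set.Icc s t, (l' x - f s - c * (x - s)) * (r * (x₀ - s)) ≤ M * (x - s) := by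
      intro x hx
      have h3 : (l' x - f s - c * (x - s)) * (x₀ - s) ≤ y * (x - s) := le_trans
        (mul_le_mul_of_nonneg_right (by linarith [min_le_left (l x) (f P + c * (x - P))])
          (by linarith [hx₀.1])) (h1 x hx)
      rw [hr]
      nlinarith
    have hl'2 : ∀ x ∈ Set.Icc s t, (l' x - f s - c * (x - s)) * (r * (t - x₀)) ≤ M * (t - x) := by
      intro x hx
      have h3 : (l' x - f s - c * (x - s)) * (t - x₀) ≤ y * (t - x) := le_trans
        (mul_le_mul_of_nonneg_right (by linarith [min_le_left (l x) (f P + c * (x - P))])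
          (by linarith [hx₀.2])) (h2 x hx)
      rw [hr]
      nlinarith
    have hfl' : ∀ x ∈ Set.Icc s t, f x ≤ l' x := fun x hx =>
      le_min (hfl x hx) (hPtan x ⟨has.trans hx.1, hx.2.trans htb⟩)
    set w := M / (P - s) with hw
    have hwM : w * (P - s) = M := by rw [hw]; field_simp
    have hw0 : 0 ≤ w := div_nonneg hM0 hu.le
    set z := M / (t - P) with hz
    have hzM : z * (t - P) = M := by rw [hz]; field_simp
    have hz0 : 0 ≤ z := div_nonneg hM0 hv.le
    -- The new apex is where the left edge of the old triangle reaches height `M`; its height is now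
    -- measured from the chord over `[s, P]`, steeper by `w`. The right side is symmetric.
    obtain ⟨Λ₁, hΛ₁c, hΛ₁f, hΛ₁⟩ := ih s P (s + r * (x₀ - s)) (w * (P - s - r * (x₀ - s))) (c + w)
      l' has (hPt.le.trans htb) hsP.le ⟨by linarith, by linarith⟩
      (mul_nonneg hw0 (by linarith)) (by linarith) (fun x hx => hfl' x ⟨hx.1, hx.2.trans hPt.le⟩)
      (fun x hx => by
        have h3 := hl'1 x ⟨hx.1, hx.2.trans hPt.le⟩
        rw [← hwM] at h3
        linarith)
      (fun x hx => by
        have h3 : l' x - f s - (c + w) * (x - s) ≤ w * (P - x) := by linarith [hl'M x]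
        have h4 := mul_le_mul_of_nonneg_right h3 (show 0 ≤ P - s - r * (x₀ - s) by linarith)
        linarith)
    obtain ⟨Λ₂, hΛ₂c, hΛ₂f, hΛ₂⟩ := ih P t (t - r * (t - x₀)) (z * (t - P - r * (t - x₀))) (c - z)
      l' (has.trans hsP.le) htb hPt.le ⟨by linarith, by linarith⟩
      (mul_nonneg hz0 (by linarith)) (by linarith)
      (fun x hx => hfl' x ⟨hsP.le.trans hx.1, hx.2⟩)
      (fun x hx => by
        have h3 : l' x - f P - (c - z) * (x - P) ≤ z * (x - P) := by linarith [hl'M x]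
        have h4 := mul_le_mul_of_nonneg_right h3 (show 0 ≤ t - P - r * (t - x₀) by linarith)
        linarith)
      (fun x hx => by
        have h3 := hl'2 x ⟨hsP.le.trans hx.1, hx.2⟩
        have h4 : l' x - f P - (c - z) * (x - P) = (l' x - f s - c * (x - s)) - z * (t - x) := by
          linarith
        rw [h4]
        rw [← hzM] at h3
        linarith)
    refine ⟨insert (c, f P - c * P) (Λ₁ ∪ Λ₂), ?_, ?_, fun ψ hψ hψl hψΛ => ?_⟩
    · have := Finset.card_insert_le (c, f P - c * P) (Λ₁ ∪ Λ₂)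
      have := Finset.card_union_le Λ₁ Λ₂
      rw [pow_succ]
      omega
    · intro d hd x hx
      rcases Finset.mem_insert.1 hd with rfl | hd
      · linarith [hPtan x hx]
      · rcases Finset.mem_union.1 hd with hd | hd
        · exact hΛ₁f d hd x hx
        · exact hΛ₂f d hd x hx
    · have hψl' : ∀ x ∈ Set.Icc s t, ψ x ≤ l' x := fun x hx => by
        refine le_min (hψl x hx) ?_
        have := hψΛ _ (Finset.mem_insert_self _ _) x hx
        simp only at this
        linarith
      have hsub : ∀ {u v : ℝ}, a ≤ u → v ≤ b → u ≤ v →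
          IntervalIntegrable (fun x => ψ x - f x) volume u v := fun hu hv huv =>
        ((hψ.sub hcont).mono (Set.Icc_subset_Icc hu hv)).intervalIntegrable_of_Icc huv
      rw [← intervalIntegral.integral_add_adjacent_intervals
        (hsub has (hPt.le.trans htb) hsP.le) (hsub (has.trans hsP.le) htb hPt.le)]
      have e1 := hΛ₁ ψ hψ (fun x hx => hψl' x ⟨hx.1, hx.2.trans hPt.le⟩) fun d hd x hx =>
        hψΛ d (Finset.mem_insert_of_mem (Finset.mem_union_left _ hd)) x ⟨hx.1, hx.2.trans hPt.le⟩
      have e2 := hΛ₂ ψ hψ (fun x hx => hψl' x ⟨hsP.le.trans hx.1, hx.2⟩) fun d hd x hx =>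
        hψΛ d (Finset.mem_insert_of_mem (Finset.mem_union_right _ hd)) x ⟨hsP.le.trans hx.1, hx.2⟩
      refine (add_le_add e1 e2).trans ?_
      -- Base times height, summed over the two new triangles, is the old value times `r (1 - r) ≤ 1
      -- / 4`.
      have e3 : (P - s) * (w * (P - s - r * (x₀ - s))) + (t - P) * (z * (t - P - r * (t - x₀)))
          = (t - s) * y * (r * (1 - r)) := by
        rw [show (P - s) * (w * (P - s - r * (x₀ - s))) = w * (P - s) * (P - s - r * (x₀ - s)) by ring,
          show (t - P) * (z * (t - P - r * (t - x₀))) = z * (t - P) * (t - P - r * (t - x₀)) by ring,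
          hwM, hzM, hr]
        ring
      rw [← add_div, e3, pow_succ, mul_comm ((4 : ℝ) ^ L), ← div_div]
      have h4 : 0 ≤ (t - s) * y := mul_nonneg (by linarith) hy
      gcongr
      have : r * (1 - r) ≤ 1 / 4 := by nlinarith [sq_nonneg (r - 1 / 2)]
      nlinarith

end Majorants

/-! ### Minima of finitely many affine functions -/

theorem cutBy_sInf_of_isUpperSet {S : Set ℝ} (hS : IsUpperSet S) : CutBy {sInf S} S := by
  intro I hI hdis
  by_contra! hcon
  obtain ⟨h1, h2⟩ := hcon
  obtain ⟨y, hyI, hyS⟩ := Set.not_subset.1 h1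
  obtain ⟨x, hxI, hxS⟩ := Set.not_disjoint_iff.1 h2
  have hlb : y ∈ lowerBounds S := fun s hs => by
    by_contra! hsy
    exact hyS (hS hsy.le hs)
  have : sInf S ∈ I := hI.out hyI hxI ⟨le_csInf ⟨x, hxS⟩ hlb, csInf_le ⟨y, hlb⟩ hxS⟩
  exact Set.disjoint_left.1 hdis this (by simp)

/-- The minimum of the affine functions `x ↦ d.1 * x + d.2`, `d ∈ Λ`. -/
def minAffine (Λ : Finset (ℝ × ℝ)) (hΛ : Λ.Nonempty) (x : ℝ) : ℝ :=
  Λ.inf' hΛ fun d => d.1 * x + d.2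

theorem minAffine_le {Λ : Finset (ℝ × ℝ)} (hΛ : Λ.Nonempty) {d : ℝ × ℝ} (hd : d ∈ Λ) (x : ℝ) :
    minAffine Λ hΛ x ≤ d.1 * x + d.2 := Finset.inf'_le _ hd

theorem continuous_minAffine {Λ : Finset (ℝ × ℝ)} (hΛ : Λ.Nonempty) :
    Continuous (minAffine Λ hΛ) :=
  Continuous.finset_inf'_apply hΛ fun d _ => by fun_prop

theorem concaveOn_minAffine {Λ : Finset (ℝ × ℝ)} (hΛ : Λ.Nonempty) :
    ConcaveOn ℝ Set.univ (minAffine Λ hΛ) := by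
  refine ⟨convex_univ, fun x _ y _ u v hu hv huv => ?_⟩
  refine Finset.le_inf' _ _ fun d hd => ?_
  have h1 := mul_le_mul_of_nonneg_left (minAffine_le hΛ hd x) hu
  have h2 := mul_le_mul_of_nonneg_left (minAffine_le hΛ hd y) hv
  simp only [smul_eq_mul]
  have e : d.1 * (u * x + v * y) + d.2 = u * (d.1 * x + d.2) + v * (d.1 * y + d.2) := by
    have : v = 1 - u := by linarith
    subst this
    ring
  rw [e]
  linarith

/-- Lines are added by increasing slope. The steepest one lies strictly above the minimum of the
others exactly on an upper set, so it creates at most one break. -/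
theorem exists_breaks_minAffine {Λ : Finset (ℝ × ℝ)} : ∀ hΛ : Λ.Nonempty,
    ∃ B : Finset ℝ, B.card ≤ Λ.card ∧ ∀ I : Set ℝ, I.OrdConnected → Disjoint I B →
      ∃ a b : ℝ, ∀ x ∈ I, minAffine Λ hΛ x = a * x + b := by
  classical
  refine Finset.induction_on_max_value (Prod.fst : ℝ × ℝ → ℝ) Λ ?_ ?_
  · exact fun h => absurd h (by simp)
  · intro d Λ hd hmax ih hΛ'
    rcases Λ.eq_empty_or_nonempty with rfl | hΛ
    · exact ⟨∅, by simp, fun I _ _ => ⟨d.1, d.2, fun x _ => by simp [minAffine]⟩⟩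
    obtain ⟨B, hBc, hB⟩ := ih hΛ
    have e : ∀ x, minAffine (insert d Λ) hΛ' x = min (d.1 * x + d.2) (minAffine Λ hΛ x) :=
      fun x => Finset.inf'_insert hΛ _
    set S := {x | minAffine Λ hΛ x < d.1 * x + d.2} with hS
    have hSu : IsUpperSet S := fun x z hxz hx => by
      obtain ⟨d', hd', h⟩ := Finset.exists_mem_eq_inf' hΛ fun d => d.1 * x + d.2
      have h1 : d'.1 * x + d'.2 < d.1 * x + d.2 := by
        have : minAffine Λ hΛ x < d.1 * x + d.2 := hx
        rwa [minAffine, h] at this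
      have h2 := minAffine_le hΛ hd' z
      have h3 := mul_le_mul_of_nonneg_right (hmax d' hd') (sub_nonneg.2 hxz)
      change minAffine Λ hΛ z < d.1 * z + d.2
      linarith
    refine ⟨insert (sInf S) B, ?_, fun I hI hdis => ?_⟩
    · rw [Finset.card_insert_of_notMem hd]
      exact (Finset.card_insert_le _ _).trans (by omega)
    · rw [Set.disjoint_left] at hdis
      simp only [Finset.coe_insert, Set.mem_insert_iff, not_or] at hdis
      rcases cutBy_sInf_of_isUpperSet hSu I hI
        (Set.disjoint_left.2 fun x hx => by simpa using (hdis hx).1) with h | h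
      · obtain ⟨u, v, huv⟩ := hB I hI (Set.disjoint_left.2 fun x hx => (hdis hx).2)
        refine ⟨u, v, fun x hx => ?_⟩
        rw [e, ← huv x hx]
        exact min_eq_right (le_of_lt (h hx))
      · refine ⟨d.1, d.2, fun x hx => ?_⟩
        rw [e]
        exact min_eq_left (not_lt.1 fun hlt => Set.disjoint_left.1 h hx hlt)

/-! ### A piecewise affine majorant that is close in `L₁` -/

theorem le_integral_of_concaveOn {f : ℝ → ℝ} {a b s t : ℝ} (hf : ConcaveOn ℝ (Set.Icc a b) f)
    (hcont : ContinuousOn f (Set.Icc a b)) (has : a ≤ s) (htb : t ≤ b) (hst : s ≤ t) :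
    (t - s) * (f s + f t) / 2 ≤ ∫ x in s..t, f x := by
  rcases hst.eq_or_lt with rfl | hst'
  · simp
  have hpos : 0 < t - s := by linarith
  set c := (f t - f s) / (t - s) with hc
  have hc' : f t = f s + c * (t - s) := by rw [hc]; field_simp; ring
  have hi : IntervalIntegrable f volume s t :=
    (hcont.mono (Set.Icc_subset_Icc has htb)).intervalIntegrable_of_Icc hst
  have h := intervalIntegral.integral_mono_on hst (f := fun x => (f s - c * s) + c * x)
    (Continuous.intervalIntegrable (by fun_prop) s t) hi fun x hx => by
      have := chord_le_of_concaveOn hf has htb hst' hc' hx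
      linarith
  refine le_trans (le_of_eq ?_) h
  rw [intervalIntegral.integral_add (by simp) (Continuous.intervalIntegrable (by fun_prop) s t),
    intervalIntegral.integral_const, intervalIntegral.integral_const_mul, integral_id, hc',
    smul_eq_mul]
  ring

/-- The horizontal line at the maximum starts the recursion on each side of a maximiser, with right
triangles whose apexes sit above `a` and `b`. The trapezoid bound on `∫ f` controls them. The count
is `1 + 2 (2 ^ L - 1)` lines. -/
theorem exists_affine_majorant {f : ℝ → ℝ} {a b : ℝ} (hab : a ≤ b)
    (hf : ConcaveOn ℝ (Set.Icc a b) f) (hcont : ContinuousOn f (Set.Icc a b))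
    (hf0 : ∀ x ∈ Set.Icc a b, 0 ≤ f x) (L : ℕ) :
    ∃ ψ : ℝ → ℝ, Continuous ψ ∧ ConcaveOn ℝ Set.univ ψ ∧ (∀ x ∈ Set.Icc a b, f x ≤ ψ x) ∧
      (∃ m ∈ Set.Icc a b, ∀ x, ψ x ≤ ψ m) ∧
      (∃ B : Finset ℝ, B.card + 1 ≤ 2 * 2 ^ L ∧ ∀ I : Set ℝ, I.OrdConnected → Disjoint I B →
        ∃ u v : ℝ, ∀ x ∈ I, ψ x = u * x + v) ∧
      ∫ x in a..b, (ψ x - f x) ≤ 2 * (∫ x in a..b, f x) / 4 ^ L := by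
  classical
  obtain ⟨m, ⟨ham, hmb⟩, hmax⟩ := isCompact_Icc.exists_isMaxOn (Set.nonempty_Icc.2 hab) hcont
  have hmax' : ∀ x ∈ Set.Icc a b, f x ≤ f m := hmax
  have haI : a ∈ Set.Icc a b := ⟨le_rfl, hab⟩
  have hbI : b ∈ Set.Icc a b := ⟨hab, le_rfl⟩
  set c₁ := (f m - f a) / (m - a) with hc₁
  have hc₁' : c₁ * (m - a) = f m - f a := by
    rcases ham.eq_or_lt with h | h
    · rw [← h]; simp
    · have : 0 < m - a := by linarith
      rw [hc₁]; field_simp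
  set c₂ := (f b - f m) / (b - m) with hc₂
  have hc₂' : c₂ * (b - m) = f b - f m := by
    rcases hmb.eq_or_lt with h | h
    · rw [← h]; simp
    · have : 0 < b - m := by linarith
      rw [hc₂]; field_simp
  obtain ⟨Λ₁, hΛ₁c, hΛ₁f, hΛ₁⟩ := exists_majorants hf hcont L a m a (f m - f a) c₁ (fun _ => f m)
    le_rfl hmb ham ⟨le_rfl, ham⟩ (by linarith [hmax' a haI]) (by linarith)
    (fun x hx => hmax' x ⟨hx.1, hx.2.trans hmb⟩)
    (fun x hx => by
      have := mul_nonneg (sub_nonneg.2 (hmax' a haI)) (sub_nonneg.2 hx.1)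
      simpa using this)
    (fun x hx => le_of_eq (by
      have : (f m - f a - c₁ * (x - a)) * (m - a) = (f m - f a) * (m - a) - c₁ * (m - a) * (x - a) := by
        ring
      rw [this, hc₁']; ring))
  obtain ⟨Λ₂, hΛ₂c, hΛ₂f, hΛ₂⟩ := exists_majorants hf hcont L m b b (f m - f b) c₂ (fun _ => f m)
    ham le_rfl hmb ⟨hmb, le_rfl⟩ (by linarith [hmax' b hbI]) (by linarith)
    (fun x hx => hmax' x ⟨ham.trans hx.1, hx.2⟩)
    (fun x hx => le_of_eq (by
      have : (f m - f m - c₂ * (x - m)) * (b - m) = - (c₂ * (b - m)) * (x - m) := by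
        ring
      rw [this, hc₂']; ring))
    (fun x hx => by
      have := mul_nonneg (sub_nonneg.2 (hmax' b hbI)) (sub_nonneg.2 hx.2)
      simpa using this)
  set Λ := insert ((0 : ℝ), f m) (Λ₁ ∪ Λ₂) with hΛ
  have hne : Λ.Nonempty := Finset.insert_nonempty _ _
  have hle : ∀ x, minAffine Λ hne x ≤ f m := fun x => by
    simpa using minAffine_le hne (Finset.mem_insert_self _ _) x
  have hge : ∀ x ∈ Set.Icc a b, f x ≤ minAffine Λ hne x := fun x hx => by
    refine Finset.le_inf' _ _ fun d hd => ?_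
    rcases Finset.mem_insert.1 hd with rfl | hd
    · simpa using hmax' x hx
    · rcases Finset.mem_union.1 hd with hd | hd
      · exact hΛ₁f d hd x hx
      · exact hΛ₂f d hd x hx
  have hψc : Continuous (minAffine Λ hne) := continuous_minAffine hne
  refine ⟨minAffine Λ hne, hψc, concaveOn_minAffine hne, hge,
    ⟨m, ⟨ham, hmb⟩, fun x => (hle x).trans (hge m ⟨ham, hmb⟩)⟩, ?_, ?_⟩
  · obtain ⟨B, hBc, hB⟩ := exists_breaks_minAffine hne
    refine ⟨B, ?_, hB⟩
    have h1 : Λ.card ≤ (Λ₁ ∪ Λ₂).card + 1 := Finset.card_insert_le _ _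
    have h2 := Finset.card_union_le Λ₁ Λ₂
    omega
  · have hii : ∀ {u v : ℝ}, a ≤ u → v ≤ b → u ≤ v →
        IntervalIntegrable f volume u v := fun hu hv huv =>
      (hcont.mono (Set.Icc_subset_Icc hu hv)).intervalIntegrable_of_Icc huv
    have hid : ∀ {u v : ℝ}, a ≤ u → v ≤ b → u ≤ v →
        IntervalIntegrable (fun x => minAffine Λ hne x - f x) volume u v := fun hu hv huv =>
      (hψc.intervalIntegrable _ _).sub (hii hu hv huv)
    rw [← intervalIntegral.integral_add_adjacent_intervals (hid le_rfl hmb ham)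
      (hid ham le_rfl hmb), ← intervalIntegral.integral_add_adjacent_intervals
      (hii le_rfl hmb ham) (hii ham le_rfl hmb)]
    have e1 := hΛ₁ _ hψc.continuousOn (fun x _ => hle x) fun d hd x _ =>
      minAffine_le hne (Finset.mem_insert_of_mem (Finset.mem_union_left _ hd)) x
    have e2 := hΛ₂ _ hψc.continuousOn (fun x _ => hle x) fun d hd x _ =>
      minAffine_le hne (Finset.mem_insert_of_mem (Finset.mem_union_right _ hd)) x
    have e3 := le_integral_of_concaveOn hf hcont le_rfl hmb ham
    have e4 := le_integral_of_concaveOn hf hcont ham le_rfl hmb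
    refine (add_le_add e1 e2).trans ?_
    rw [← add_div]
    gcongr
    have e5 := mul_nonneg (sub_nonneg.2 ham) (hf0 a haI)
    have e6 := mul_nonneg (sub_nonneg.2 hmb) (hf0 b hbI)
    nlinarith

/-! ### Densities and their laws -/

theorem law_real {p : ℝ → ℝ} (hp : IsDensity p) {S : Set ℝ} (hS : MeasurableSet S) :
    (law p).real S = ∫ x in S, p x := by
  rw [measureReal_def, law, withDensity_apply _ hS,
    integral_eq_lintegral_of_nonneg_ae (Filter.Eventually.of_forall hp.nonneg)
      hp.measurable.aestronglyMeasurable]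

theorem isProbabilityMeasure_law {p : ℝ → ℝ} (hp : IsDensity p) : IsProbabilityMeasure (law p) :=
  ⟨by
    rw [law, withDensity_apply _ MeasurableSet.univ, Measure.restrict_univ,
      ← ofReal_integral_eq_lintegral_ofReal hp.integrable (Filter.Eventually.of_forall hp.nonneg),
      hp.integral_eq_one, ENNReal.ofReal_one]⟩

instance nullSingletonClass_law (p : ℝ → ℝ) : NullSingletonClass (law p) :=
  nullSingletonClass_withDensity _

theorem integrable_abs_sub {p q : ℝ → ℝ} (hp : Integrable p) (hq : Integrable q) :
    Integrable fun x => |p x - q x| := (hp.sub hq).abs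

theorem dist₁_eq_ofReal {p q : ℝ → ℝ} (hp : Integrable p) (hq : Integrable q) :
    dist₁ p q = ENNReal.ofReal (∫ x, |p x - q x|) := by
  rw [dist₁, eLpNorm_one_eq_lintegral_enorm, ← ofReal_integral_norm_eq_lintegral_enorm (f := fun x => p x - q x) (hp.sub hq)]
  rfl

theorem integral_abs_sub_le {p q r : ℝ → ℝ} (hp : Integrable p) (hq : Integrable q)
    (hr : Integrable r) :
    ∫ x, |p x - r x| ≤ (∫ x, |p x - q x|) + ∫ x, |q x - r x| := by
  rw [← integral_add (integrable_abs_sub hp hq) (integrable_abs_sub hq hr)]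
  exact integral_mono (integrable_abs_sub hp hr)
    ((integrable_abs_sub hp hq).add (integrable_abs_sub hq hr))
    fun x => abs_sub_le _ _ _

section Densities

variable {p q : ℝ → ℝ}

theorem integral_max_sub (hp : IsDensity p) (hq : IsDensity q) :
    ∫ x, max (q x - p x) 0 = (∫ x, |p x - q x|) / 2 := by
  have e : ∀ x, max (q x - p x) 0 = (|p x - q x| + (q x - p x)) / 2 := fun x => by
    rcases le_total (q x) (p x) with h | h
    · rw [max_eq_right (by linarith), abs_of_nonneg (by linarith)]; ring
    · rw [max_eq_left (by linarith), abs_of_nonpos (by linarith)]; ring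
  simp only [e]
  have hpi := hp.integrable
  have hqi := hq.integrable
  have hqp : Integrable fun x => q x - p x := hqi.sub hpi
  rw [integral_div, integral_add (integrable_abs_sub hpi hqi) hqp, integral_sub hqi hpi,
    hp.integral_eq_one, hq.integral_eq_one]
  simp

theorem law_sub_law_le (hp : IsDensity p) (hq : IsDensity q) {S : Set ℝ} (hS : MeasurableSet S) :
    (law q).real S - (law p).real S ≤ (∫ x, |p x - q x|) / 2 := by
  rw [law_real hp hS, law_real hq hS, ← integral_sub hq.integrable.integrableOn
    hp.integrable.integrableOn, ← integral_max_sub hp hq]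
  have hi : Integrable fun x => max (q x - p x) 0 := (hq.integrable.sub hp.integrable).pos_part
  refine (setIntegral_mono (hq.integrable.sub hp.integrable).integrableOn hi.integrableOn
    fun x => le_max_left _ _).trans ?_
  exact setIntegral_le_integral hi (Filter.Eventually.of_forall fun x => le_max_right _ _)

theorem law_sub_law_lt_eq (hp : IsDensity p) (hq : IsDensity q) :
    (law q).real {x | p x < q x} - (law p).real {x | p x < q x} = (∫ x, |p x - q x|) / 2 := by
  have hS : MeasurableSet {x | p x < q x} := measurableSet_lt hp.measurable hq.measurable
  rw [law_real hp hS, law_real hq hS, ← integral_sub hq.integrable.integrableOn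
    hp.integrable.integrableOn, ← integral_max_sub hp hq, ← integral_indicator hS]
  refine integral_congr_ae (Filter.Eventually.of_forall fun x => ?_)
  simp only [Set.indicator_apply, Set.mem_ofPred_eq]
  split_ifs with h
  · exact (max_eq_left (by linarith)).symm
  · exact (max_eq_right (by linarith)).symm

theorem integral_abs_sub_le_two (hp : IsDensity p) (hq : IsDensity q) :
    ∫ x, |p x - q x| ≤ 2 := by
  have := integral_mono (integrable_abs_sub hp.integrable hq.integrable) (hp.integrable.add hq.integrable)
    fun x => show |p x - q x| ≤ p x + q x by
      have h1 := hp.nonneg x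
      have h2 := hq.nonneg x
      rw [abs_le]; constructor <;> linarith
  rw [integral_add' hp.integrable hq.integrable, hp.integral_eq_one, hq.integral_eq_one] at this
  linarith

end Densities

/-! ### Approximation of concave densities -/

theorem ordConnected_of_mem_pieces {A : Finset ℝ} {I : Set ℝ} (hI : I ∈ pieces A) :
    I.OrdConnected := by
  obtain ⟨x, -, rfl⟩ := hI
  infer_instance

theorem disjoint_of_mem_pieces {A : Finset ℝ} {I : Set ℝ} (hI : I ∈ pieces A) : Disjoint I A := by
  obtain ⟨x, -, rfl⟩ := hI
  exact Set.disjoint_left.2 fun y hy => Set.ordConnectedComponent_subset hy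

theorem subset_Iio_or_subset_Ioi {I : Set ℝ} (hI : I.OrdConnected) {a : ℝ} (ha : a ∉ I) :
    I ⊆ Set.Iio a ∨ I ⊆ Set.Ioi a := by
  by_contra! h
  obtain ⟨x, hx, hx'⟩ := Set.not_subset.1 h.1
  obtain ⟨y, hy, hy'⟩ := Set.not_subset.1 h.2
  exact ha (hI.out hy hx ⟨not_lt.1 hy', not_lt.1 hx'⟩)

/-- The interior of the interval has full mass and `p` is continuous there; inner regularity then
gives the compact interval, away from possible jumps at the ends. -/
theorem exists_compact_concave_part {p : ℝ → ℝ} (hp : p ∈ concaveDensities) {η : ℝ} (hη : 0 < η) :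
    ∃ a b : ℝ, a ≤ b ∧ ConcaveOn ℝ (Set.Icc a b) p ∧
      ContinuousOn p (Set.Icc a b) ∧ 1 - η ≤ ∫ x in a..b, p x := by
  obtain ⟨hd, I, hI, hI0, hIc⟩ := hp
  have := isProbabilityMeasure_law hd
  have hint : (law p) (interior I) = 1 := by
    rw [prob_compl_eq_zero_iff isOpen_interior.measurableSet |>.symm]
    have hsub : (interior I)ᶜ ⊆ Iᶜ ∪ frontier I := fun x hx => by
      by_cases hxI : x ∈ I
      · exact Or.inr ⟨subset_closure hxI, hx⟩
      · exact Or.inl hxI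
    refine measure_mono_null hsub (measure_union_null ?_ ?_)
    · rw [law, withDensity_apply _ hI.measurableSet.compl]
      refine (setLIntegral_congr_fun (g := fun _ => 0) hI.measurableSet.compl fun x hx => ?_).trans
        (by simp)
      simp [hI0 x hx]
    · exact withDensity_absolutelyContinuous _ _ (hIc.1.addHaar_frontier volume)
  have hlt : ENNReal.ofReal (1 - η) < law p (interior I) := by
    rw [hint, ← ENNReal.ofReal_one]
    exact (ENNReal.ofReal_lt_ofReal_iff one_pos).2 (by linarith)
  obtain ⟨K, hK, hKc, hKlt⟩ := isOpen_interior.measurableSet.exists_lt_isCompact_of_ne_top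
    (measure_ne_top _ _) hlt
  have hne : K.Nonempty := by
    rw [Set.nonempty_iff_ne_empty]
    rintro rfl
    simp at hKlt
  have ha := hKc.sInf_mem hne
  have hb := hKc.sSup_mem hne
  set a := sInf K
  set b := sSup K
  have hsub : K ⊆ Set.Icc a b := fun t ht =>
    ⟨csInf_le hKc.bddBelow ht, le_csSup hKc.bddAbove ht⟩
  have hab : a ≤ b := (hsub ha).2
  have hio : (interior I).OrdConnected := hI.interior
  have hin : Set.Icc a b ⊆ interior I := hio.out (hK ha) (hK hb)
  refine ⟨a, b, hab, hIc.subset (hin.trans interior_subset) (convex_Icc a b),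
    hIc.continuousOn_interior.mono hin, ?_⟩
  rw [intervalIntegral.integral_of_le hab, ← integral_Icc_eq_integral_Ioc,
    ← law_real hd measurableSet_Icc]
  have h1 := hKlt.le.trans (measure_mono hsub)
  rw [← ofReal_measureReal, ENNReal.ofReal_le_ofReal_iff measureReal_nonneg] at h1
  exact h1

theorem monotoneOn_Iic_of_concaveOn {ψ : ℝ → ℝ} (hψ : ConcaveOn ℝ Set.univ ψ) {m : ℝ}
    (hm : ∀ x, ψ x ≤ ψ m) : MonotoneOn ψ (Set.Iic m) := by
  intro x _ y hy hxy
  rcases (show y ≤ m from hy).eq_or_lt with rfl | hym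
  · exact hm x
  · by_contra! hlt
    have hxm : x ≤ m := hxy.trans hym.le
    have h : min (ψ x) (ψ m) ≤ ψ y := hψ.ge_on_segment (Set.mem_univ x) (Set.mem_univ m)
      (by rw [segment_eq_Icc hxm]; exact ⟨hxy, hym.le⟩)
    rw [min_eq_left (hm x)] at h
    linarith

theorem antitoneOn_Ici_of_concaveOn {ψ : ℝ → ℝ} (hψ : ConcaveOn ℝ Set.univ ψ) {m : ℝ}
    (hm : ∀ x, ψ x ≤ ψ m) : AntitoneOn ψ (Set.Ici m) := by
  intro x hx y _ hxy
  have hmy : m ≤ y := le_trans hx hxy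
  have h : min (ψ m) (ψ y) ≤ ψ x := hψ.ge_on_segment (Set.mem_univ m) (Set.mem_univ y)
    (by rw [segment_eq_Icc hmy]; exact ⟨hx, hxy⟩)
  rwa [min_eq_right (hm y)] at h

theorem continuousWithinAt_Iic_indicator_Ioc {ψ : ℝ → ℝ} (hψ : Continuous ψ) {a b : ℝ} (x : ℝ) :
    ContinuousWithinAt ((Set.Ioc a b).indicator ψ) (Set.Iic x) x := by
  rcases le_or_gt x a with hxa | hxa
  · refine (continuousWithinAt_const (b := (0 : ℝ))).congr (fun y hy => ?_) ?_
    · exact Set.indicator_of_notMem (fun h => absurd h.1 (not_lt.2 (le_trans hy hxa))) _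
    · exact Set.indicator_of_notMem (fun h => absurd h.1 (not_lt.2 hxa)) _
  rcases le_or_gt x b with hxb | hxb
  · refine hψ.continuousWithinAt.congr_of_eventuallyEq ?_ (Set.indicator_of_mem (show x ∈ Set.Ioc a b from ⟨hxa, hxb⟩) _)
    filter_upwards [self_mem_nhdsWithin, mem_nhdsWithin_of_mem_nhds (Ioi_mem_nhds hxa)] with y h1 h2
    exact Set.indicator_of_mem (show y ∈ Set.Ioc a b from ⟨h2, le_trans h1 hxb⟩) _
  · refine (continuousWithinAt_const (b := (0 : ℝ))).congr_of_eventuallyEq ?_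
      (Set.indicator_of_notMem (fun h => absurd h.2 (not_le.2 hxb)) _)
    filter_upwards [mem_nhdsWithin_of_mem_nhds (Ioi_mem_nhds hxb)] with y h1
    exact Set.indicator_of_notMem (fun h => absurd h.2 (not_le.2 h1)) _

theorem indicator_mem_Obar {ψ : ℝ → ℝ} {a b m : ℝ} {B : Finset ℝ} {D : ℕ} (hψ : Continuous ψ)
    (hc : ConcaveOn ℝ Set.univ ψ) (hab : a ≤ b) (h0 : ∀ x ∈ Set.Icc a b, 0 ≤ ψ x)
    (h1 : ∫ x in a..b, ψ x = 1) (hm : ∀ x, ψ x ≤ ψ m)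
    (hB : ∀ I : Set ℝ, I.OrdConnected → Disjoint I B → ∃ u v : ℝ, ∀ x ∈ I, ψ x = u * x + v)
    (hBD : B.card + 1 ≤ D) : (Set.Ioc a b).indicator ψ ∈ Obar D 4 := by
  classical
  set g := (Set.Ioc a b).indicator ψ with hg
  have hout : ∀ I : Set ℝ, I ⊆ Set.Iio a ∨ I ⊆ Set.Ioi b → ∀ x ∈ I, g x = 0 := by
    rintro I (hI | hI) x hx
    · exact Set.indicator_of_notMem (fun h => absurd h.1 (not_lt.2 (le_of_lt (hI hx)))) _
    · exact Set.indicator_of_notMem (fun h => absurd h.2 (not_le.2 (hI hx))) _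
  have hin : ∀ I : Set ℝ, I ⊆ Set.Ioi a → I ⊆ Set.Iio b → ∀ x ∈ I, g x = ψ x :=
    fun I ha hb x hx => Set.indicator_of_mem (show x ∈ Set.Ioc a b from ⟨ha hx, le_of_lt (hb hx)⟩) _
  -- The half-open interval makes the indicator left-continuous; the maximiser `m` separates the two
  -- monotone parts.
  refine ⟨⟨⟨hψ.measurable.indicator measurableSet_Ioc, ?_, ?_, ?_⟩, {a, m, b}, by simp,
    Finset.card_le_three, fun I hI => ?_⟩, continuousWithinAt_Iic_indicator_Ioc hψ,
    insert a (insert b B), by simp, ?_, fun I hI => ?_⟩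
  · exact fun x => Set.indicator_nonneg (fun y hy => h0 y (Set.Ioc_subset_Icc_self hy)) x
  · exact (integrable_indicator_iff measurableSet_Ioc).2
      ((hψ.continuousOn.integrableOn_Icc).mono_set Set.Ioc_subset_Icc_self)
  · rw [integral_indicator measurableSet_Ioc, ← intervalIntegral.integral_of_le hab, h1]
  · have hIo := ordConnected_of_mem_pieces hI
    have hId := disjoint_of_mem_pieces hI
    have hnot : ∀ c ∈ ({a, m, b} : Finset ℝ), c ∉ I := fun c hc hcI =>
      Set.disjoint_left.1 hId hcI hc
    have hzero : (∀ x ∈ I, g x = 0) → IsMonotoneOn g I ∧ IsConvexConcaveOn g I := fun h =>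
      ⟨Or.inl fun x hx y hy _ => by rw [h x hx, h y hy],
        Or.inl ((convexOn_const 0 hIo.convex).congr fun x hx => (h x hx).symm)⟩
    rcases subset_Iio_or_subset_Ioi hIo (hnot a (by simp)) with ha | ha
    · exact hzero (hout I (Or.inl ha))
    rcases subset_Iio_or_subset_Ioi hIo (hnot b (by simp)) with hb | hb
    swap
    · exact hzero (hout I (Or.inr hb))
    have heq : Set.EqOn ψ g I := fun x hx => (hin I ha hb x hx).symm
    refine ⟨?_, Or.inr ((hc.subset (Set.subset_univ _) hIo.convex).congr heq)⟩
    rcases subset_Iio_or_subset_Ioi hIo (hnot m (by simp)) with hm' | hm'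
    · exact Or.inl (((monotoneOn_Iic_of_concaveOn hc hm).mono
        (hm'.trans Set.Iio_subset_Iic_self)).congr heq)
    · exact Or.inr (((antitoneOn_Ici_of_concaveOn hc hm).mono
        (hm'.trans Set.Ioi_subset_Ici_self)).congr heq)
  · have := Finset.card_insert_le a (insert b B)
    have := Finset.card_insert_le b B
    omega
  · have hIo := ordConnected_of_mem_pieces hI
    have hId := Set.disjoint_left.1 (disjoint_of_mem_pieces hI)
    simp only [Finset.coe_insert, Set.mem_insert_iff, not_or] at hId
    rcases subset_Iio_or_subset_Ioi hIo (fun h => (hId h).1 rfl) with ha | ha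
    · exact ⟨0, 0, fun x hx => by simpa using hout I (Or.inl ha) x hx⟩
    rcases subset_Iio_or_subset_Ioi hIo (fun h => (hId h).2.1 rfl) with hb | hb
    swap
    · exact ⟨0, 0, fun x hx => by simpa using hout I (Or.inr hb) x hx⟩
    obtain ⟨u, v, huv⟩ := hB I hIo (Set.disjoint_left.2 fun x hx => (hId hx).2.2)
    exact ⟨u, v, fun x hx => by rw [hin I ha hb x hx, huv x hx]⟩

theorem exists_mem_Obar_integral_abs_sub_le {p : ℝ → ℝ} (hp : p ∈ concaveDensities) (L : ℕ) {η : ℝ}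
    (hη : 0 < η) (hη1 : η < 1) :
    ∃ q ∈ Obar (2 * 2 ^ L) 4, ∫ x, |p x - q x| ≤ 2 * (2 / 4 ^ L + η) := by
  obtain ⟨a, b, hab, hcv, hcont, hmass⟩ := exists_compact_concave_part hp hη
  have hd := hp.1
  have hpi : ∀ u v : ℝ, IntervalIntegrable p volume u v := fun u v =>
    hd.integrable.intervalIntegrable
  have hp1 : ∫ x in a..b, p x ≤ 1 := by
    rw [intervalIntegral.integral_of_le hab, ← hd.integral_eq_one]
    exact setIntegral_le_integral hd.integrable (Filter.Eventually.of_forall hd.nonneg)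
  obtain ⟨ψ, hψc, hψcv, hψge, ⟨m, -, hm⟩, ⟨B, hBc, hB⟩, herr⟩ :=
    exists_affine_majorant hab hcv hcont (fun x _ => hd.nonneg x) L
  have hψi : IntervalIntegrable ψ volume a b := hψc.intervalIntegrable _ _
  set e := ∫ x in a..b, (ψ x - p x) with he
  have he' : e = (∫ x in a..b, ψ x) - ∫ x in a..b, p x :=
    intervalIntegral.integral_sub hψi (hpi a b)
  have he0 : 0 ≤ e := intervalIntegral.integral_nonneg hab fun x hx => sub_nonneg.2 (hψge x hx)
  have he1 : e ≤ 2 / 4 ^ L := herr.trans (by gcongr; linarith)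
  set M := ∫ x in a..b, ψ x with hM
  have hM0 : 0 < M := by linarith
  have hψ0 : ∀ x ∈ Set.Icc a b, 0 ≤ ψ x := fun x hx => (hd.nonneg x).trans (hψge x hx)
  set φ : ℝ → ℝ := fun x => M⁻¹ * ψ x with hφ
  have hφc : Continuous φ := continuous_const.mul hψc
  have hmem : (Set.Ioc a b).indicator φ ∈ Obar (2 * 2 ^ L) 4 := by
    refine indicator_mem_Obar (m := m) hφc (hψcv.smul (inv_pos.2 hM0).le) hab
      (fun x hx => mul_nonneg (inv_pos.2 hM0).le (hψ0 x hx)) ?_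
      (fun x => mul_le_mul_of_nonneg_left (hm x) (inv_pos.2 hM0).le) (B := B)
      (fun I hI hd => ?_) hBc
    · simp only [hφ]
      rw [intervalIntegral.integral_const_mul, ← hM, inv_mul_cancel₀ hM0.ne']
    · obtain ⟨u, v, huv⟩ := hB I hI hd
      exact ⟨M⁻¹ * u, M⁻¹ * v, fun x hx => by simp only [hφ]; rw [huv x hx]; ring⟩
  refine ⟨_, hmem, ?_⟩
  have hgi := hmem.1.1.integrable
  have hki : Integrable ((Set.Ioc a b).indicator ψ) :=
    (integrable_indicator_iff measurableSet_Ioc).2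
      ((hψc.continuousOn.integrableOn_Icc).mono_set Set.Ioc_subset_Icc_self)
  refine (integral_abs_sub_le hd.integrable hki hgi).trans ?_
  have e1 : ∫ x, |p x - (Set.Ioc a b).indicator ψ x| = e + (1 - ∫ x in a..b, p x) := by
    rw [← integral_add_compl measurableSet_Ioc (integrable_abs_sub hd.integrable hki)]
    congr 1
    · rw [he, intervalIntegral.integral_of_le hab]
      refine setIntegral_congr_fun measurableSet_Ioc fun x hx => ?_
      simp only [Set.indicator_of_mem hx]
      rw [abs_of_nonpos (by linarith [hψge x (Set.Ioc_subset_Icc_self hx)])]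
      ring
    · have h := integral_add_compl (s := Set.Ioc a b) measurableSet_Ioc hd.integrable
      rw [hd.integral_eq_one, ← intervalIntegral.integral_of_le hab] at h
      rw [← h, add_sub_cancel_left]
      refine setIntegral_congr_fun measurableSet_Ioc.compl fun x hx => ?_
      simp only [Set.indicator_of_notMem hx, sub_zero]
      exact abs_of_nonneg (hd.nonneg x)
  have e2 : ∫ x, |(Set.Ioc a b).indicator ψ x - (Set.Ioc a b).indicator φ x| = |M - 1| := by
    have : ∀ x, |(Set.Ioc a b).indicator ψ x - (Set.Ioc a b).indicator φ x|
        = |1 - M⁻¹| * (Set.Ioc a b).indicator ψ x := fun x => by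
      by_cases hx : x ∈ Set.Ioc a b
      · simp only [Set.indicator_of_mem hx, hφ]
        rw [show ψ x - M⁻¹ * ψ x = (1 - M⁻¹) * ψ x by ring, abs_mul,
          abs_of_nonneg (hψ0 x (Set.Ioc_subset_Icc_self hx))]
      · simp [Set.indicator_of_notMem hx]
    simp only [this]
    rw [integral_const_mul, integral_indicator measurableSet_Ioc,
      ← intervalIntegral.integral_of_le hab, ← hM]
    nth_rewrite 2 [← abs_of_pos hM0]
    rw [← abs_mul, sub_mul, inv_mul_cancel₀ hM0.ne', one_mul]
  rw [e1, e2]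
  -- The excess `e` of the majorant and the lost mass push `M - 1` in opposite directions;
  -- normalising costs no more than truncation and majorisation together, hence the overall factor
  -- 2.
  have : |M - 1| ≤ e + η := by rw [abs_le]; constructor <;> linarith
  linarith

/-! ### The risk of TV-estimators -/

section Criterion

variable {n : ℕ} {M : Set (ℝ → ℝ)}

theorem testSum_le (x : Fin n → ℝ) (p q : ℝ → ℝ) : testSum x p q ≤ n := by
  refine (Finset.sum_le_sum (g := fun _ => (1 : ℝ)) fun i _ => ?_).trans (by simp)
  have h1 : Set.indicator {y | p y < q y} (1 : ℝ → ℝ) (x i) ≤ 1 :=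
    Set.indicator_le_self' (fun _ _ => zero_le_one) _
  have h2 : 0 ≤ (law p).real {y | p y < q y} := measureReal_nonneg
  unfold test
  linarith

theorem testSum_self (x : Fin n → ℝ) (p : ℝ → ℝ) : testSum x p p = 0 := by
  simp [testSum, test]

theorem bddAbove_testSum (x : Fin n → ℝ) (p : ℝ → ℝ) :
    BddAbove (Set.range fun q : M => testSum x p q) :=
  ⟨n, by rintro _ ⟨q, rfl⟩; exact testSum_le x p q⟩

theorem testSum_le_crit (x : Fin n → ℝ) (p : ℝ → ℝ) {q : ℝ → ℝ} (hq : q ∈ M) :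
    testSum x p q ≤ crit M x p :=
  le_ciSup (bddAbove_testSum x p) (⟨q, hq⟩ : M)

theorem bddBelow_crit (x : Fin n → ℝ) : BddBelow (Set.range fun p : M => crit M x p) :=
  ⟨0, by rintro _ ⟨p, rfl⟩; exact (testSum_self x _).symm.trans_le (testSum_le_crit x _ p.2)⟩

theorem testSum_eq (hn : 1 ≤ n) (x : Fin n → ℝ) (p q r : ℝ → ℝ) :
    testSum x p q = n * (empDev (law r) x {y | p y < q y}
      + ((law r).real {y | p y < q y} - (law p).real {y | p y < q y})) := by
  have hn' : (0 : ℝ) < n := by exact_mod_cast hn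
  simp only [testSum, test, empDev, Finset.sum_sub_distrib]
  simp
  field_simp

/-- Testing against `p₀` bounds the criterion at `p'` below by about `n ‖p' - p₀‖ / 2`, while the
criterion at `p₀` is at most `n (u + ‖p - p₀‖ / 2)`. Every set involved compares `p₀` with an
element of `M`. -/
theorem integral_abs_sub_le_of_crit_le (hn : 1 ≤ n) (hM : ∀ q ∈ M, IsDensity q) {x : Fin n → ℝ}
    {p p' p₀ : ℝ → ℝ} (hp : IsDensity p) (h₀ : p₀ ∈ M) (h' : p' ∈ M) {ε u : ℝ}
    (hcrit : crit M x p' ≤ (⨅ q : M, crit M x q) + ε)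
    (hu : ∀ q ∈ M, |empDev (law p) x {y | p₀ y < q y}| ≤ u ∧
      |empDev (law p) x {y | q y < p₀ y}| ≤ u) :
    ∫ y, |p y - p' y| ≤ 3 * (∫ y, |p y - p₀ y|) + 4 * u + 2 * ε / n := by
  have hn' : (0 : ℝ) < n := by exact_mod_cast hn
  have d₀ := hM _ h₀
  have d' := hM _ h'
  set d := ∫ y, |p y - p₀ y| with hd
  set d₂ := ∫ y, |p' y - p₀ y| with hd₂
  have hd' : ∫ y, |p₀ y - p y| = d := by simp only [hd, abs_sub_comm]
  have hd₂' : ∫ y, |p₀ y - p' y| = d₂ := by simp only [hd₂, abs_sub_comm]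
  have htri := integral_abs_sub_le hp.integrable d₀.integrable d'.integrable
  rw [hd₂', ← hd] at htri
  have h1 : crit M x p₀ ≤ n * (u + d / 2) := by
    have : Nonempty M := ⟨⟨p₀, h₀⟩⟩
    refine ciSup_le fun q => ?_
    rw [testSum_eq hn x p₀ q p]
    have h2 := law_sub_law_le d₀ hp (measurableSet_lt d₀.measurable (hM q q.2).measurable)
    rw [hd'] at h2
    have h3 := (le_abs_self _).trans (hu q q.2).1
    gcongr
  have h2 : n * (d₂ / 2 - d / 2 - u) ≤ testSum x p' p₀ := by
    rw [testSum_eq hn x p' p₀ p]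
    have h3 := law_sub_law_lt_eq d' d₀
    have h4 := law_sub_law_le hp d₀ (measurableSet_lt d'.measurable d₀.measurable)
    have h5 := (neg_le_abs _).trans (hu p' h').2
    refine mul_le_mul_of_nonneg_left ?_ hn'.le
    linarith
  have h3 : crit M x p' ≤ crit M x p₀ + ε :=
    hcrit.trans (add_le_add_left (ciInf_le (bddBelow_crit x) (⟨p₀, h₀⟩ : M)) ε)
  have h4 : n * (d₂ / 2 - d / 2 - u) ≤ n * (u + d / 2) + ε :=
    h2.trans ((testSum_le_crit x p' h₀).trans (h3.trans (by linarith)))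
  have h5 : d₂ / 2 - d / 2 - u ≤ u + d / 2 + ε / n := by
    have : n * (u + d / 2 + ε / n) = n * (u + d / 2) + ε := by field_simp
    rw [← this] at h4
    exact le_of_mul_le_mul_left h4 hn'
  have h6 : 2 * ε / n = 2 * (ε / n) := by ring
  rw [h6]
  linarith

end Criterion

theorem risk_le_of_forall_le {n : ℕ} {p : ℝ → ℝ} (hp : IsDensity p) (pt : DensityEstimator n)
    {V : (Fin n → ℝ) → ℝ} (hV : Integrable V (Measure.pi fun _ => law p))
    (h : ∀ x, ∫ y, |p y - pt.toFun x y| ≤ V x) :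
    risk p pt ≤ ENNReal.ofReal (∫ x, V x ∂(Measure.pi fun _ : Fin n => law p)) := by
  have hV0 : ∀ x, 0 ≤ V x := fun x => (integral_nonneg fun y => abs_nonneg _).trans (h x)
  rw [ofReal_integral_eq_lintegral_ofReal hV (Filter.Eventually.of_forall hV0), risk]
  refine lintegral_mono fun x => ?_
  rw [dist₁_eq_ofReal hp.integrable (pt.isDensity x).integrable]
  exact ENNReal.ofReal_le_ofReal (h x)

/-- With `t = n ^ (1/5)` in `[R, 2 R]`, the constants are `320 = 60 + 104 * 5 / 2` and `451 = 104 *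
4 + 35`, the `35` being slack. -/
theorem rate_le {n R : ℕ} (hn : 1 ≤ n) (hR : 1 ≤ R) (h1 : R ^ 5 ≤ n) (h2 : n < (2 * R) ^ 5) :
    15 / (R : ℝ) ^ 2 + 104 * √((6 * R + 14 : ℝ) / n)
      ≤ 320 / (n : ℝ) ^ ((2 : ℝ) / 5) + 451 / √(n : ℝ) := by
  have hn0 : (0 : ℝ) < n := by exact_mod_cast hn
  have hR0 : (0 : ℝ) < R := by exact_mod_cast hR
  set t : ℝ := (n : ℝ) ^ ((1 : ℝ) / 5) with ht
  have ht0 : 0 < t := Real.rpow_pos_of_pos hn0 _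
  have ht5 : t ^ 5 = n := by
    rw [ht, ← Real.rpow_natCast, ← Real.rpow_mul hn0.le]
    norm_num
  have ht2 : (n : ℝ) ^ ((2 : ℝ) / 5) = t ^ 2 := by
    rw [ht, ← Real.rpow_natCast, ← Real.rpow_mul hn0.le]
    norm_num
  have hRt : (R : ℝ) ≤ t := by
    refine le_of_pow_le_pow_left₀ (n := 5) (by norm_num) ht0.le ?_
    rw [ht5]
    exact_mod_cast h1
  have htR : t ≤ 2 * R := by
    refine le_of_pow_le_pow_left₀ (n := 5) (by norm_num) (by positivity) ?_
    rw [ht5]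
    exact_mod_cast h2.le
  have e1 : 15 / (R : ℝ) ^ 2 ≤ 60 / t ^ 2 := by
    rw [div_le_div_iff₀ (by positivity) (by positivity)]
    nlinarith
  have e2 : √((6 * R + 14 : ℝ) / n) ≤ 5 / 2 / t ^ 2 + 4 / √n := by
    rw [Real.sqrt_le_left (by positivity)]
    have hs : √(n : ℝ) ^ 2 = n := Real.sq_sqrt hn0.le
    have h3 : (6 * R + 14 : ℝ) / n ≤ 25 / 4 / t ^ 4 + 16 / n := by
      have : 25 / 4 / t ^ 4 = 25 / 4 * t / n := by
        rw [← ht5]; field_simp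
      rw [this, ← add_div]
      gcongr <;> linarith
    have h4 : (5 / 2 / t ^ 2 + 4 / √n) ^ 2
        = 25 / 4 / t ^ 4 + 16 / √n ^ 2 + 20 / (t ^ 2 * √n) := by field_simp; ring
    rw [h4, hs]
    have : 0 ≤ 20 / (t ^ 2 * √(n : ℝ)) := by positivity
    linarith
  rw [ht2]
  have e3 : 320 / t ^ 2 + 451 / √(n : ℝ) = 60 / t ^ 2 + 104 * (5 / 2 / t ^ 2 + 4 / √n) + 35 / √n := by
    field_simp
    ring
  have e4 : 0 ≤ 35 / √(n : ℝ) := by positivity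
  linarith

theorem risk_tvEstimator_le {n : ℕ} (hn : 1 ≤ n) {O : ℕ → Set (ℝ → ℝ)} {M : Set (ℝ → ℝ)}
    (hO : ∀ D, 1 ≤ D → IsCountableDense (O D) (Obar D 4)) (hM : M ⊆ Mbar 4)
    (hOM : ∀ D, 1 ≤ D → O D ⊆ M) {ε : ℝ} (hε : 0 < ε) {phat : DensityEstimator n}
    (hphat : IsTVEstimator M ε phat) {p : ℝ → ℝ} (hp : p ∈ concaveDensities) :
    risk p phat ≤
      ENNReal.ofReal (320 / (n : ℝ) ^ ((2 : ℝ) / 5) + 451 / √(n : ℝ) + 2 * ε / n) := by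
  have hn0 : (0 : ℝ) < n := by exact_mod_cast hn
  have hd := hp.1
  have := isProbabilityMeasure_law hd
  -- For small `n` the trivial bound 2 suffices; from 32 on, `R ≥ 2`, which ensures `6 R + 14 ≤ R ^
  -- 5 ≤ n`.
  rcases lt_or_ge n 32 with hlt | hge
  · refine (risk_le_of_forall_le hd phat (V := fun _ => 2) (integrable_const _) fun x =>
      integral_abs_sub_le_two hd (phat.isDensity x)).trans (ENNReal.ofReal_le_ofReal ?_)
    have h1 : √(n : ℝ) ≤ 6 := by
      rw [Real.sqrt_le_left (by norm_num)]
      have : (n : ℝ) ≤ 32 := by exact_mod_cast hlt.le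
      linarith
    have h2 : 2 ≤ 451 / √(n : ℝ) := by
      rw [le_div_iff₀ (Real.sqrt_pos.2 hn0)]; linarith
    have h3 : 0 ≤ 320 / (n : ℝ) ^ ((2 : ℝ) / 5) := by positivity
    have h4 : 0 ≤ 2 * ε / n := by positivity
    simp only [integral_const, probReal_univ, one_smul]
    linarith
  set L := Nat.log 32 n with hL
  set R := 2 ^ L with hR
  have hL1 : 1 ≤ L := Nat.log_pos (by norm_num) hge
  have hR2 : 2 ≤ R := by
    rw [hR]
    calc 2 = 2 ^ 1 := rfl
      _ ≤ 2 ^ L := Nat.pow_le_pow_right (by norm_num) hL1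
  have hR5 : R ^ 5 = 32 ^ L := by rw [hR, ← pow_mul, mul_comm, pow_mul]; norm_num
  have h1 : R ^ 5 ≤ n := by
    rw [hR5]
    exact Nat.pow_log_le_self 32 (by omega)
  have h2 : n < (2 * R) ^ 5 := by
    rw [mul_pow, hR5]
    have := Nat.lt_pow_succ_log_self (b := 32) (by norm_num) n
    rw [← hL, pow_succ] at this
    norm_num
    omega
  have hmn : 3 * (2 * R) + 14 ≤ n := by
    refine le_trans ?_ h1
    have : 2 ^ 4 ≤ R ^ 4 := Nat.pow_le_pow_left hR2 4
    calc 3 * (2 * R) + 14 ≤ 2 ^ 4 * R := by omega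
      _ ≤ R ^ 4 * R := Nat.mul_le_mul_right R this
      _ = R ^ 5 := by ring
  have hRr : (0 : ℝ) < R := by positivity
  have hR4 : (4 : ℝ) ^ L = (R : ℝ) ^ 2 := by
    rw [hR]; push_cast
    rw [← pow_mul, mul_comm, pow_mul]; norm_num
  have hR1 : (1 : ℝ) ≤ R := by exact_mod_cast (by omega : 1 ≤ R)
  have hη1 : 1 / (4 * (R : ℝ) ^ 2) < 1 := by
    rw [div_lt_one (by positivity)]
    nlinarith
  obtain ⟨p₁, hp₁, hpp₁⟩ := exists_mem_Obar_integral_abs_sub_le hp L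
    (η := 1 / (4 * (R : ℝ) ^ 2)) (by positivity) hη1
  have hD : 1 ≤ 2 * 2 ^ L := Nat.mul_pos two_pos (pow_pos two_pos L)
  obtain ⟨p₀, hp₀, hpp₀⟩ := (hO _ hD).dense p₁ hp₁ (1 / (2 * (R : ℝ) ^ 2)) (by positivity)
  have hp₀' := (hO _ hD).subset hp₀
  rw [dist₁_eq_ofReal hp₁.1.1.integrable hp₀'.1.1.integrable,
    ENNReal.ofReal_lt_ofReal_iff (by positivity)] at hpp₀
  -- The five units are `4` from the majorant, `1 / 2` from the truncation and `1 / 2` from the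
  -- passage to the countable dense set.
  have hdist : ∫ y, |p y - p₀ y| ≤ 5 / (R : ℝ) ^ 2 := by
    refine (integral_abs_sub_le hd.integrable hp₁.1.1.integrable hp₀'.1.1.integrable).trans
      ((add_le_add hpp₁ hpp₀.le).trans (le_of_eq ?_))
    rw [hR4]
    field_simp
    norm_num
  obtain ⟨U, hUi, hUint, hU⟩ := exists_uniform_empDev_bound (n := n) (μ := law p)
    (m := 3 * (2 * R) + 14) (by omega) hmn
  have hp₀M := hOM _ hD hp₀
  refine (risk_le_of_forall_le hd phat
    (V := fun x => 3 * (5 / (R : ℝ) ^ 2) + 4 * U x + 2 * ε / n)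
    (((integrable_const _).add (hUi.const_mul 4)).add (integrable_const _)) fun x => ?_).trans
    (ENNReal.ofReal_le_ofReal ?_)
  · refine (integral_abs_sub_le_of_crit_le hn (fun q hq => (hM hq).1) hd hp₀M (hphat x).1
      (hphat x).2 (u := U x) fun q hq => ?_).trans (by gcongr)
    have hq' := hM hq
    obtain ⟨⟨B, hBc, hB⟩, B', hBc', hB'⟩ := exists_cutBy_lt hq' hp₀'
    exact ⟨hU B _ (measurableSet_lt hp₀'.1.1.measurable hq'.1.measurable) hB hBc x,
      hU B' _ (measurableSet_lt hq'.1.measurable hp₀'.1.1.measurable) hB' hBc' x⟩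
  · have i1 : Integrable (fun x => 4 * U x) (Measure.pi fun _ : Fin n => law p) := hUi.const_mul 4
    have i2 : ∫ x, 4 * U x ∂(Measure.pi fun _ : Fin n => law p)
        = 4 * ∫ x, U x ∂(Measure.pi fun _ : Fin n => law p) := integral_const_mul _ _
    rw [integral_add ((integrable_const _).fun_add i1) (integrable_const _),
      integral_add (integrable_const _) i1, i2]
    simp only [integral_const, probReal_univ, one_smul]
    have hrate := rate_le hn (by omega) h1 h2
    have e : ((3 * (2 * R) + 14 : ℕ) : ℝ) = 6 * R + 14 := by push_cast; ring
    rw [e] at hUint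
    have e2 : 3 * (5 / (R : ℝ) ^ 2) = 15 / (R : ℝ) ^ 2 := by ring
    rw [e2]
    linarith

/-! ### Existence of TV-estimators -/

theorem exists_isCountableDense {N : Set (ℝ → ℝ)} (hN : ∀ p ∈ N, Integrable p) :
    ∃ M, IsCountableDense M N := by
  set φ : N → Lp ℝ 1 (volume : Measure ℝ) := fun p => (hN p p.2).toL1 p.1 with hφ
  have : Fact ((1 : ℝ≥0∞) ≠ ∞) := ⟨ENNReal.one_ne_top⟩
  obtain ⟨C, hC, hCd⟩ := TopologicalSpace.exists_countable_dense (Set.range φ)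
  choose g hg using fun s : Set.range φ => s.2
  refine ⟨(fun s => (g s : ℝ → ℝ)) '' C, hC.image _, ?_, fun p hp δ hδ => ?_⟩
  · rintro _ ⟨s, -, rfl⟩
    exact (g s).2
  · have hδ' : 0 < ENNReal.ofReal δ := ENNReal.ofReal_pos.2 hδ
    obtain ⟨s, hs, hsC⟩ := hCd.exists_mem_open (Metric.isOpen_eball (x := (⟨φ ⟨p, hp⟩, ⟨p, hp⟩, rfl⟩ :
      Set.range φ)) (ε := ENNReal.ofReal δ)) ⟨_, Metric.mem_eball_self hδ'⟩
    refine ⟨_, ⟨s, hs, rfl⟩, ?_⟩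
    have h1 : edist (s : Lp ℝ 1 (volume : Measure ℝ)) (φ ⟨p, hp⟩) < ENNReal.ofReal δ := hsC
    rw [edist_comm, ← hg s] at h1
    simp only [hφ] at h1
    rwa [Integrable.toL1, Integrable.toL1, Lp.edist_toLp_toLp] at h1

theorem Obar_subset_Mbar (D k : ℕ) : Obar D k ⊆ Mbar k := fun _ h => h.1

theorem Obar_nonempty : (Obar 1 4).Nonempty := by
  refine ⟨_, indicator_mem_Obar (ψ := fun _ => 1) (a := 0) (b := 1) (m := 0) (B := ∅)
    continuous_const (concaveOn_const 1 convex_univ) zero_le_one (fun _ _ => zero_le_one) (by simp)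
    (fun _ => le_rfl) (fun I _ _ => ⟨0, 1, by simp⟩) (by simp)⟩

theorem measurable_testSum {n : ℕ} {p q : ℝ → ℝ} (hp : Measurable p) (hq : Measurable q) :
    Measurable fun x : Fin n → ℝ => testSum x p q := by
  refine Finset.measurable_sum _ fun i _ => Measurable.sub_const ?_ _
  exact (measurable_one.indicator (measurableSet_lt hp hq)).comp (measurable_pi_apply i)

/-- Enumerate `M` and take the first element within `ε` of the infimum: the index is measurable, and
any function of a discrete index is strongly measurable. -/
theorem exists_isTVEstimator (n : ℕ) {M : Set (ℝ → ℝ)} (hM : M.Countable) (hne : M.Nonempty)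
    (hMd : ∀ q ∈ M, IsDensity q) {ε : ℝ} (hε : 0 < ε) :
    ∃ pt : DensityEstimator n, IsTVEstimator M ε pt := by
  classical
  have : Countable M := hM.to_subtype
  have : Nonempty M := hne.to_subtype
  obtain ⟨e, he⟩ := exists_surjective_nat M
  have hcrit : ∀ q : M, Measurable fun x : Fin n → ℝ => crit M x q := fun q =>
    Measurable.iSup fun q' => measurable_testSum (hMd q q.2).measurable (hMd q' q'.2).measurable
  have hinf : Measurable fun x : Fin n → ℝ => ⨅ q : M, crit M x q := Measurable.iInf hcrit
  have hex : ∀ x : Fin n → ℝ, ∃ k, crit M x (e k) ≤ (⨅ q : M, crit M x q) + ε := fun x => by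
    obtain ⟨q, hq⟩ := exists_lt_of_ciInf_lt (lt_add_of_pos_right (⨅ q : M, crit M x q) hε)
    obtain ⟨k, rfl⟩ := he q
    exact ⟨k, hq.le⟩
  have hfind : Measurable fun x : Fin n → ℝ => Nat.find (hex x) :=
    measurable_find hex fun k => measurableSet_le (hcrit (e k)) (hinf.add_const ε)
  refine ⟨⟨fun x => e (Nat.find (hex x)), fun x => hMd _ (e _).2, ?_⟩,
    fun x => ⟨(e _).2, Nat.find_spec (hex x)⟩⟩
  have h : StronglyMeasurable fun k : ℕ => (hMd _ (e k).2).integrable.toL1 (e k : ℝ → ℝ) :=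
    StronglyMeasurable.of_discrete
  exact h.comp_measurable hfind

theorem iInf_iSup_risk_le {n : ℕ} (hn : 1 ≤ n) :
    (⨅ pt : DensityEstimator n, ⨆ p ∈ concaveDensities, risk p pt) ≤
      ENNReal.ofReal (320 / (n : ℝ) ^ ((2 : ℝ) / 5) + 451 / √(n : ℝ)) := by
  have hn0 : (0 : ℝ) < n := by exact_mod_cast hn
  choose O hO using fun D : ℕ => exists_isCountableDense (N := Obar D 4) fun p hp => hp.1.1.integrable
  -- Density of `M` in `Mbar 4` is not needed for the risk bound, so this union is enough.
  set M : Set (ℝ → ℝ) := ⋃ D, O D with hM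
  have hMc : M.Countable := Set.countable_iUnion fun D => (hO D).countable
  have hMM : M ⊆ Mbar 4 := Set.iUnion_subset fun D => (hO D).subset.trans (Obar_subset_Mbar D 4)
  have hne : M.Nonempty := by
    obtain ⟨p, hp⟩ := Obar_nonempty
    obtain ⟨q, hq, -⟩ := (hO 1).dense p hp 1 one_pos
    exact ⟨q, Set.mem_iUnion.2 ⟨1, hq⟩⟩
  refine ENNReal.le_of_forall_pos_le_add fun δ hδ _ => ?_
  have hδ' : (0 : ℝ) < δ := by exact_mod_cast hδ
  -- This `ε` makes the term `2 * ε / n` equal to the allowed excess `δ`.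
  obtain ⟨pt, hpt⟩ := exists_isTVEstimator n hMc hne (fun q hq => (hMM hq).1)
    (ε := n * δ / 2) (by positivity)
  refine (iInf_le _ pt).trans (iSup₂_le fun p hp => ?_)
  refine (risk_tvEstimator_le hn (fun D _ => hO D) hMM (fun D _ => Set.subset_iUnion O D)
    (by positivity) hpt hp).trans (le_of_eq ?_)
  rw [show 2 * (n * (δ : ℝ) / 2) / n = δ by field_simp, ENNReal.ofReal_add (by positivity) hδ'.le,
    ENNReal.ofReal_coe_nnreal]

end TVEst

end

theorem mainTheorem3 (n : ℕ) (hn : 1 ≤ n) :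
    (∀ (O : ℕ → Set (ℝ → ℝ)) (M : Set (ℝ → ℝ)),
      (∀ D, 1 ≤ D → TVEst.IsCountableDense (O D) (TVEst.Obar D 4)) →
      TVEst.IsCountableDense M (TVEst.Mbar 4) →
      (∀ D, 1 ≤ D → O D ⊆ M) →
      ∀ (ε : ℝ), 0 < ε → ∀ phat : TVEst.DensityEstimator n, TVEst.IsTVEstimator M ε phat →
        ∀ p ∈ TVEst.concaveDensities,
          TVEst.risk p phat ≤
            ENNReal.ofReal (320 / (n : ℝ) ^ ((2 : ℝ) / 5) + 451 / √(n : ℝ) + 2 * ε / n)) ∧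
    (⨅ pt : TVEst.DensityEstimator n, ⨆ p ∈ TVEst.concaveDensities, TVEst.risk p pt) ≤
      ENNReal.ofReal (320 / (n : ℝ) ^ ((2 : ℝ) / 5) + 451 / √(n : ℝ)) :=
  ⟨fun _ _ hO hM hOM _ hε _ hphat _ hp =>
    TVEst.risk_tvEstimator_le hn hO hM.subset hOM hε hphat hp, TVEst.iInf_iSup_risk_le hn⟩
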